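/- **Theorem A.** Let $S$ be a finite set and let $T$ be the generator of a continuous-time Markov chain on $S$ (that is, $T_{ij}\ge 0$ for $i\ne j$ and $\sum_j T_{ij}=0$). Let $(\kappa(t))_{t\ge 0}$ be, under probability measures $\mathbb P_i$, $i\in S$, a right-continuous Markov chain with generator $T$ and $\kappa(0)=i$ $\mathbb P_i$-almost surely. Let $c\in\mathbb R^S$ with $c_i\neq 0$ for all $i$, and let $X(t)=\int_0^t c_{\kappa(u)}\,du$ be the fluid level, started from $X(0)=0$, with first return time $\tau=\inf\{t>0: X(t)=0\}\in[0,\infty]$ to level $0$. Put $S_+=\{i: c_i>0\}$ and $S_-=\{i: c_i<0\}$, partition $T$ into blocks $T_{++},T_{+-},T_{-+},T_{--}$ accordingly, and let $C_+=\mathrm{diag}(c_i)_{i\in S_+}$ and $|C_-|=\mathrm{diag}(|c_i|)_{i\in S_-}$. Let $\Psi$ be the $S_+\times S_-$ matrix of first return probabilities, $\Psi_{ij}=\mathbb P_i[\tau<\infty,\ \kappa(\tau)=j]$, and $$K = C_+^{-1}T_{++}+\Psi\,|C_-|^{-1}\,T_{-+},\qquad \mathcal F(K;x)=\int_0^x e^{Ku}\,du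 .$$ For $x\ge 0$ let $\Gamma(x)$ be the matrix, with rows indexed by $S_+$ and columns by $S=S_+\cup S_-$, of mean sojourn times in $[0,x]$ before the return to level $0$, starting from a phase of positive growth: $$\Gamma_{ij}(x)=\mathbb E_i\Big[\int_0^{\tau}\mathbf 1\{X(s)\in[0,x],\ \kappa(s)=j\}\,ds\Big].$$ Then, for every $x\ge 0$ (whatever the sign of the mean drift), all entries of $\Gamma(x)$ are finite and $$\Gamma(x)=\mathcal F(K;x)\,\bigl[\,C_+^{-1}\ \ \ \Psi\,|C_-|^{-1}\,\bigr].$$ -/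

import Mathlib

open MeasureTheory
open scoped NNReal ENNReal Topology

noncomputable section

namespace FluidQueue

/-- `T` is the (conservative) generator of a continuous-time Markov chain on the finite set `S`. -/
structure IsGenerator {S : Type*} [Fintype S] (T : Matrix S S ℝ) : Prop where
  nonneg_offDiag : ∀ i j, i ≠ j → 0 ≤ T i j
  row_sum : ∀ i, ∑ j, T i j = 0

/-- The σ-algebra generated by the process `κ` up to time `s`. -/
abbrev past {S Ω : Type*} [MeasurableSpace S] (κ : ℝ≥0 → Ω → S) (s : ℝ≥0) : MeasurableSpace Ω :=
  ⨆ r : Set.Iic s, MeasurableSpace.comap (κ r) inferInstance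

/-- `κ` is, under the probability measures `P i`, a continuous-time Markov chain with generator `T`
started in `i`: it has right-continuous paths (for the discrete topology on `S`), and the Markov
property with transition matrices `exp (t T)` holds. -/
structure IsMarkovFamily {S Ω : Type*} [Fintype S] [DecidableEq S] [MeasurableSpace S]
    [MeasurableSpace Ω] (T : Matrix S S ℝ) (κ : ℝ≥0 → Ω → S) (P : S → Measure Ω) : Prop where
  isProb : ∀ i, IsProbabilityMeasure (P i)
  measurable : ∀ t, Measurable (κ t)
  rightCts : ∀ ω t, ∀ᶠ s in 𝓝[≥] t, κ s ω = κ t ω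
  initial : ∀ i, ∀ᵐ ω ∂(P i), κ 0 ω = i
  markov : ∀ (i : S) (s t : ℝ≥0) (A : Set Ω), MeasurableSet[past κ s] A → ∀ j k : S,
    (P i).real (A ∩ {ω | κ s ω = j} ∩ {ω | κ (s + t) ω = k}) =
      (P i).real (A ∩ {ω | κ s ω = j}) * NormedSpace.exp ((t : ℝ) • T) j k

section Paths

variable {S Ω : Type*}

/-- The fluid level `X(t) = ∫₀ᵗ c_{κ(u)} du`, started from level `0`. -/
def level (c : S → ℝ) (κ : ℝ≥0 → Ω → S) (t : ℝ≥0) (ω : Ω) : ℝ :=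
  ∫ u in (0 : ℝ)..t, c (κ u.toNNReal ω)

/-- The first return time to level `0`, `τ = inf {t > 0 : X(t) = 0}`, equal to `∞` if there is no
return. -/
def returnTime (c : S → ℝ) (κ : ℝ≥0 → Ω → S) (ω : Ω) : ℝ≥0∞ :=
  ⨅ t ∈ {t : ℝ≥0 | 0 < t ∧ level c κ t ω = 0}, (t : ℝ≥0∞)

/-- The time spent in `[0, x] × {j}` before the first return to level `0`. -/
def sojourn (c : S → ℝ) (κ : ℝ≥0 → Ω → S) (x : ℝ) (j : S) (ω : Ω) : ℝ≥0∞ :=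
  volume {s : ℝ | 0 ≤ s ∧ ENNReal.ofReal s < returnTime c κ ω ∧
    level c κ s.toNNReal ω ∈ Set.Icc 0 x ∧ κ s.toNNReal ω = j}

end Paths

section Matrices

variable {S Ω : Type*}

/-- The phases with positive growth rate. -/
abbrev Up (c : S → ℝ) : Type _ := {i : S // 0 < c i}

/-- The phases with negative growth rate. -/
abbrev Down (c : S → ℝ) : Type _ := {i : S // c i < 0}

/-- The matrix `Γ(x)` of mean sojourn times in `[0, x]` before the first return to level `0`,
starting in a phase of positive growth; its columns are partitioned into up and down phases. -/
def Gam [MeasurableSpace Ω] (c : S → ℝ) (κ : ℝ≥0 → Ω → S) (P : S → Measure Ω) (x : ℝ) :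
    Matrix (Up c) (Up c ⊕ Down c) ℝ≥0∞ :=
  Matrix.of fun i j => ∫⁻ ω, sojourn c κ x (Sum.elim Subtype.val Subtype.val j) ω ∂(P i)

/-- The matrix `Ψ` of first return probabilities to level `0`. -/
def Psi [MeasurableSpace Ω] (c : S → ℝ) (κ : ℝ≥0 → Ω → S) (P : S → Measure Ω) :
    Matrix (Up c) (Down c) ℝ :=
  Matrix.of fun i j =>
    (P i).real {ω | returnTime c κ ω < ∞ ∧ κ (returnTime c κ ω).toNNReal ω = j}

variable [DecidableEq S]

/-- `C₊`. -/
def CUp (c : S → ℝ) : Matrix (Up c) (Up c) ℝ := Matrix.diagonal fun i => c i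

/-- `|C₋|`. -/
def absCDown (c : S → ℝ) : Matrix (Down c) (Down c) ℝ := Matrix.diagonal fun i => |c i|

variable [Fintype S]

/-- `K = C₊⁻¹ T₊₊ + Ψ |C₋|⁻¹ T₋₊`. -/
def Kmat [MeasurableSpace Ω] (T : Matrix S S ℝ) (c : S → ℝ) (κ : ℝ≥0 → Ω → S)
    (P : S → Measure Ω) : Matrix (Up c) (Up c) ℝ :=
  (CUp c)⁻¹ * T.submatrix Subtype.val Subtype.val +
    Psi c κ P * (absCDown c)⁻¹ * T.submatrix Subtype.val Subtype.val

end Matrices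

/-- `𝓕(A; x) = ∫₀ˣ exp (A u) du`, computed entrywise. -/
def F {n : Type*} [Fintype n] [DecidableEq n] (A : Matrix n n ℝ) (x : ℝ) : Matrix n n ℝ :=
  Matrix.of fun i j => ∫ u in (0 : ℝ)..x, NormedSpace.exp (u • A) i j

end FluidQueue

end

/-! Kill the process at a rate `q > 0`, and let `a_j(x)` be the mean discounted time spent in `[0,
x] × {j}` before the return `τ`, starting in an up phase `i`. Dynkin's formula for `e^{-qu} (x -
X(u))⁺ 1{κ(u) = j}`, stopped at `τ`, gives (`IsMarkovFamily.occFun_eq`) `c_j a_j(x) = x (δ_ij -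
R_ij) + ∑_k (∫₀ˣ a_k) (T - q)_kj`, where `R_ij = E_i[e^{-qτ}; τ < ∞, κ(τ) = j]`. The test function
vanishes above `x` and equals `x` at the start and, undiscounted, at the return; it turns the
expectation into a linear equation in the level. With `r = (I - R) C⁻¹` and `A = (T - q) C⁻¹`, its
solution is `a(x) = ∫₀ˣ r e^{uA} du` (`eq_integral_vecMul_exp`).

The matrix `A` has full size; boundedness reduces it. Killing makes the total occupation finite, so
`r e^{uA}` is bounded in `u ≥ 0`. A bounded solution of `γ' = γ A` whose initial value vanishes on
the up phases is zero (`eq_zero_of_bounded_flow`): otherwise `∑ c_j |γ_j|` would start negative and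
decrease exponentially. Returns occur almost surely in down phases (`IsMarkovFamily.retMat_up`), so
`r` is `C₊⁻¹` on the up columns. Taking for `K` the up columns of `r (T - q)`, the rows of `r A - K
r` vanish on the up phases and have bounded orbits. Hence `r A = K r`, so `r e^{uA} = e^{uK} r` and
`a(x) = 𝓕(K; x) r` (`eq_F_mul_of_bounded`).

Finally `q → 0`: occupation times converge by monotone convergence, `R` by dominated convergence,
and the right-hand side by continuity. The limit is finite, which gives the finiteness of `Γ(x)`
whatever the drift. -/

namespace FluidQueue

/-! ### Additive functionals of right-continuous paths: regularity and measurability. -/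

section Paths

variable {S Ω : Type*}

/-- Through `Real.toNNReal` a path is extended to negative times by its initial value, so
right-continuity holds at every real time. -/
theorem eventually_path_eq {κ : ℝ≥0 → Ω → S}
    (hr : ∀ ω t, ∀ᶠ s in 𝓝[≥] t, κ s ω = κ t ω) (ω : Ω) (t : ℝ) :
    ∀ᶠ s : ℝ in 𝓝[≥] t, κ s.toNNReal ω = κ t.toNNReal ω := by
  have h : Filter.Tendsto (fun s : ℝ => s.toNNReal) (𝓝[≥] t) (𝓝[≥] t.toNNReal) := by
    refine tendsto_nhdsWithin_iff.2 ⟨?_, ?_⟩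
    · exact (continuous_real_toNNReal.tendsto t).mono_left nhdsWithin_le_nhds
    · filter_upwards [self_mem_nhdsWithin] with s hs
      exact Real.toNNReal_le_toNNReal hs
  exact h.eventually (hr ω t.toNNReal)

/-- The additive functional `∫₀ᵗ g(κ(u)) du`. -/
noncomputable def addFun (g : S → ℝ) (κ : ℝ≥0 → Ω → S) (t : ℝ) (ω : Ω) : ℝ :=
  ∫ u in (0 : ℝ)..t, g (κ u.toNNReal ω)

theorem level_eq_addFun (c : S → ℝ) (κ : ℝ≥0 → Ω → S) (t : ℝ≥0) (ω : Ω) :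
    level c κ t ω = addFun c κ t ω := rfl

theorem addFun_zero (g : S → ℝ) (κ : ℝ≥0 → Ω → S) (ω : Ω) : addFun g κ 0 ω = 0 := by
  simp [addFun]

section

variable [MeasurableSpace S]

theorem past_le {κ : ℝ≥0 → Ω → S} [mΩ : MeasurableSpace Ω] (hm : ∀ t, Measurable (κ t)) (s : ℝ≥0) :
    past κ s ≤ mΩ := iSup_le fun r => (hm r).comap_le

theorem past_mono {κ : ℝ≥0 → Ω → S} {s t : ℝ≥0} (h : s ≤ t) : past κ s ≤ past κ t :=
  iSup_le fun r => le_iSup_of_le (⟨r.1, le_trans r.2 h⟩ : Set.Iic t) le_rfl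

theorem measurable_past (κ : ℝ≥0 → Ω → S) {s t : ℝ≥0} (h : s ≤ t) : Measurable[past κ t] (κ s) := by
  rw [measurable_iff_comap_le]
  exact le_iSup_of_le (f := fun r : Set.Iic t => MeasurableSpace.comap (κ r) inferInstance)
    (⟨s, h⟩ : Set.Iic t) le_rfl

end

variable [Fintype S]

/-- A bound for a function on a finite set. -/
noncomputable def supAbs (g : S → ℝ) : ℝ := ∑ j, |g j|

theorem abs_le_supAbs (g : S → ℝ) (j : S) : |g j| ≤ supAbs g :=
  Finset.single_le_sum (f := fun j => |g j|) (fun _ _ => abs_nonneg _) (Finset.mem_univ j)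

theorem supAbs_nonneg (g : S → ℝ) : 0 ≤ supAbs g := Finset.sum_nonneg fun _ _ => abs_nonneg _

variable [MeasurableSpace S] [MeasurableSingletonClass S]

/-- A right-continuous process with finite state space is jointly measurable. -/
theorem measurable_uncurry_of_rightCts {m : MeasurableSpace Ω} {Y : ℝ≥0 → Ω → S}
    (hm : ∀ t, Measurable (Y t)) (hr : ∀ ω t, ∀ᶠ s in 𝓝[≥] t, Y s ω = Y t ω) :
    Measurable fun p : ℝ × Ω => Y p.1.toNNReal p.2 := by
  classical
  -- Real-valued indicators are used because limits of measurable functions are taken in a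
  -- metrizable space, and `S` carries no topology.
  have key : ∀ j : S, Measurable fun p : ℝ × Ω => (Pi.single j 1 : S → ℝ) (Y p.1.toNNReal p.2) := by
    intro j
    -- The first point of the grid of mesh `1/(n+1)` strictly to the right of `r`: it takes
    -- countably many values and tends to `r` from the right.
    let d : ℕ → ℝ≥0 → ℝ≥0 := fun n r => (⌊(n + 1) * r⌋₊ + 1) / (n + 1)
    have hlt : ∀ n r, r < d n r := by
      intro n r
      simp only [d]
      rw [lt_div_iff₀ (by positivity), mul_comm]
      exact Nat.lt_floor_add_one _
    have hle : ∀ n r, d n r ≤ r + 1 / (n + 1) := by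
      intro n r
      simp only [d]
      have hn : (n : ℝ≥0) + 1 ≠ 0 := by positivity
      rw [div_le_iff₀ (by positivity), add_mul r, one_div, inv_mul_cancel₀ hn, mul_comm r]
      gcongr
      exact Nat.floor_le (by positivity)
    have hd : ∀ r, Filter.Tendsto (fun n => d n r) Filter.atTop (𝓝[≥] r) := by
      intro r
      refine tendsto_nhdsWithin_iff.2 ⟨?_, .of_forall fun n => (hlt n r).le⟩
      have h1 : Filter.Tendsto (fun n : ℕ => r + 1 / ((n : ℝ≥0) + 1)) Filter.atTop (𝓝 (r + 0)) :=
        tendsto_const_nhds.add tendsto_one_div_add_atTop_nhds_zero_nat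
      rw [add_zero] at h1
      exact tendsto_of_tendsto_of_tendsto_of_le_of_le tendsto_const_nhds h1
        (fun n => (hlt n r).le) (fun n => hle n r)
    refine measurable_of_tendsto_metrizable
      (f := fun n (p : ℝ × Ω) => (Pi.single j 1 : S → ℝ) (Y (d n p.1.toNNReal) p.2)) ?_ ?_
    · intro n
      refine (measurable_of_finite (Pi.single j 1 : S → ℝ)).comp ?_
      have h1 : Measurable fun p : ℕ × Ω => Y ((p.1 + 1) / (n + 1)) p.2 :=
        measurable_from_prod_countable_right fun k => hm ((k + 1) / (n + 1))
      have h2 : Measurable fun p : ℝ × Ω => ((⌊((n : ℝ≥0) + 1) * p.1.toNNReal⌋₊ : ℕ), p.2) := by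
        refine Measurable.prodMk ?_ measurable_snd
        exact Nat.measurable_floor.comp (by fun_prop)
      simpa only [Function.comp_def, d] using h1.comp h2
    · rw [tendsto_pi_nhds]
      intro p
      refine tendsto_const_nhds.congr' ?_
      filter_upwards [(hd p.1.toNNReal).eventually (hr p.2 p.1.toNNReal)] with n hn
      rw [hn]
  refine measurable_to_countable' fun j => ?_
  have : (fun p : ℝ × Ω => Y p.1.toNNReal p.2) ⁻¹' {j} =
      (fun p : ℝ × Ω => (Pi.single j 1 : S → ℝ) (Y p.1.toNNReal p.2)) ⁻¹' {1} := by
    ext p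
    by_cases h : Y p.1.toNNReal p.2 = j <;> simp [h, Pi.single_apply]
  rw [this]
  exact key j (measurableSet_singleton 1)

section
variable {m : MeasurableSpace Ω} {κ : ℝ≥0 → Ω → S}
  (hm : ∀ t, Measurable (κ t)) (hr : ∀ ω t, ∀ᶠ s in 𝓝[≥] t, κ s ω = κ t ω)
include hm hr

theorem measurable_path (g : S → ℝ) (ω : Ω) : Measurable fun u : ℝ => g (κ u.toNNReal ω) :=
  (measurable_of_finite g).comp
    ((measurable_uncurry_of_rightCts hm hr).comp measurable_prodMk_right)

theorem intervalIntegrable_path (g : S → ℝ) (ω : Ω) (a b : ℝ) :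
    IntervalIntegrable (fun u : ℝ => g (κ u.toNNReal ω)) volume a b := by
  refine (intervalIntegrable_const (c := supAbs g)).mono_fun
    (measurable_path hm hr g ω).aestronglyMeasurable (.of_forall fun u => ?_)
  exact (abs_le_supAbs g _).trans (le_abs_self _)

theorem addFun_sub (g : S → ℝ) (ω : Ω) (s t : ℝ) :
    addFun g κ t ω - addFun g κ s ω = ∫ u in s..t, g (κ u.toNNReal ω) :=
  intervalIntegral.integral_interval_sub_left (intervalIntegrable_path hm hr g ω _ _)
    (intervalIntegrable_path hm hr g ω _ _)

theorem abs_addFun_sub_le (g : S → ℝ) (ω : Ω) (s t : ℝ) :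
    |addFun g κ t ω - addFun g κ s ω| ≤ supAbs g * |t - s| := by
  rw [addFun_sub hm hr]
  have h : ∀ u ∈ Set.uIoc s t, ‖g (κ u.toNNReal ω)‖ ≤ supAbs g := fun u _ => abs_le_supAbs g _
  exact intervalIntegral.norm_integral_le_of_norm_le_const h

theorem abs_addFun_le (g : S → ℝ) (ω : Ω) (t : ℝ) :
    |addFun g κ t ω| ≤ supAbs g * |t| := by
  simpa [addFun_zero] using abs_addFun_sub_le hm hr g ω 0 t

theorem continuous_addFun (g : S → ℝ) (ω : Ω) : Continuous fun t => addFun g κ t ω :=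
  intervalIntegral.continuous_primitive (fun _ _ => intervalIntegrable_path hm hr g ω _ _) 0

theorem hasDerivWithinAt_addFun (g : S → ℝ) (ω : Ω) (t : ℝ) :
    HasDerivWithinAt (fun t => addFun g κ t ω) (g (κ t.toNNReal ω)) (Set.Ici t) t := by
  refine intervalIntegral.integral_hasDerivWithinAt_right (t := Set.Ioi t)
    (intervalIntegrable_path hm hr g ω _ _)
    (measurable_path hm hr g ω).stronglyMeasurable.stronglyMeasurableAtFilter ?_
  refine (tendsto_const_nhds (x := g (κ t.toNNReal ω))).congr' ?_
  filter_upwards [nhdsWithin_mono t Set.Ioi_subset_Ici_self (eventually_path_eq hr ω t)] with s hs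
  rw [hs]

theorem measurable_uncurry_addFun (g : S → ℝ) :
    Measurable fun p : ℝ × Ω => addFun g κ p.1 p.2 := by
  have h1 : Measurable fun p : ℝ × Ω => g (κ p.1.toNNReal p.2) :=
    (measurable_of_finite g).comp (measurable_uncurry_of_rightCts hm hr)
  refine (measurable_uncurry_of_continuous_of_measurable
    (u := fun (t : ℝ) (ω : Ω) => addFun g κ t ω) (continuous_addFun hm hr g) fun t => ?_)
  have h2 : StronglyMeasurable fun p : Ω × ℝ => g (κ p.2.toNNReal p.1) :=
    (h1.comp measurable_swap).stronglyMeasurable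
  simp only [addFun, intervalIntegral]
  exact (h2.integral_prod_right.sub h2.integral_prod_right).measurable

end

/-- Additive functionals are adapted. -/
theorem measurable_past_addFun {κ : ℝ≥0 → Ω → S} (hr : ∀ ω t, ∀ᶠ s in 𝓝[≥] t, κ s ω = κ t ω)
    (g : S → ℝ) {s : ℝ} {t : ℝ≥0} (hst : s ≤ t) :
    Measurable[past κ t] (addFun g κ s) := by
  -- Freezing the chain at time `t` leaves the integral up to `s ≤ t` unchanged and makes every
  -- coordinate measurable with respect to `past κ t`.
  let κ' : ℝ≥0 → Ω → S := fun r => κ (min r t)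
  have hm' : ∀ r, Measurable[past κ t] (κ' r) := fun r => measurable_past κ (min_le_right _ _)
  have hr' : ∀ ω r, ∀ᶠ s in 𝓝[≥] r, κ' s ω = κ' r ω := by
    intro ω r
    have h : Filter.Tendsto (fun s : ℝ≥0 => min s t) (𝓝[≥] r) (𝓝[≥] (min r t)) := by
      refine tendsto_nhdsWithin_iff.2 ⟨?_, ?_⟩
      · exact ((continuous_id.min continuous_const).tendsto r).mono_left nhdsWithin_le_nhds
      · filter_upwards [self_mem_nhdsWithin] with s hs
        exact min_le_min_right t hs
    exact h.eventually (hr ω (min r t))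
  have h := (measurable_uncurry_addFun (m := past κ t) hm' hr' g).comp
    (measurable_prodMk_left (x := s))
  convert h using 1
  ext ω
  simp only [addFun, Function.comp]
  refine intervalIntegral.integral_congr_ae (.of_forall fun u hu => ?_)
  have : u.toNNReal ≤ t := by
    rw [Real.toNNReal_le_iff_le_coe]
    rcases Set.mem_uIoc.1 hu with h | h
    · exact h.2.trans hst
    · exact h.2.trans t.2
  simp [κ', min_eq_left this]

end Paths

/-! ### Calculus of the matrix exponential, entry by entry. -/

section MatrixExp

variable {n : Type*} [Fintype n] [DecidableEq n]

attribute [local instance] Matrix.linftyOpNormedRing Matrix.linftyOpNormedAlgebra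

theorem hasDerivAt_exp_smul_apply (A : Matrix n n ℝ) (i j : n) (t : ℝ) :
    HasDerivAt (fun u : ℝ => NormedSpace.exp (u • A) i j) ((NormedSpace.exp (t • A) * A) i j) t := by
  have h := hasDerivAt_exp_smul_const A t
  exact ((Matrix.entryLinearMap ℝ ℝ i j).toContinuousLinearMap.hasFDerivAt).comp_hasDerivAt t h

theorem continuous_exp_matrix : Continuous (NormedSpace.exp : Matrix n n ℝ → Matrix n n ℝ) :=
  NormedSpace.exp_continuous

end MatrixExp

theorem continuous_exp_smul_apply {n : Type*} [Fintype n] [DecidableEq n] (A : Matrix n n ℝ)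
    (i j : n) : Continuous fun u : ℝ => NormedSpace.exp (u • A) i j :=
  continuous_iff_continuousAt.2 fun t => (hasDerivAt_exp_smul_apply A i j t).continuousAt

/-! ### The Markov property and the Dynkin martingale of a phase indicator. -/

section Markov

set_option linter.unusedSectionVars false

variable {S Ω : Type*} [Fintype S] [DecidableEq S] [MeasurableSpace S]
    [MeasurableSingletonClass S] [MeasurableSpace Ω]
    {T : Matrix S S ℝ} {κ : ℝ≥0 → Ω → S} {P : S → Measure Ω}

theorem abs_single_le (j a : S) : |(Pi.single j 1 : S → ℝ) a| ≤ 1 := by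
  by_cases h : a = j <;> simp [h]

theorem setIntegral_single {μ : Measure Ω} [IsFiniteMeasure μ] {Y : Ω → S} (hY : Measurable Y) (a : S)
    (A : Set Ω) : ∫ ω in A, (Pi.single a 1 : S → ℝ) (Y ω) ∂μ = μ.real (A ∩ {ω | Y ω = a}) := by
  have h1 : (fun ω => (Pi.single a 1 : S → ℝ) (Y ω)) = Set.indicator {ω | Y ω = a} 1 := by
    ext ω
    by_cases h : Y ω = a <;> simp [Set.indicator, h]
  have h2 : MeasurableSet {ω | Y ω = a} := hY (measurableSet_singleton a)
  rw [h1, integral_indicator_one h2, measureReal_restrict_apply h2, Set.inter_comm]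

theorem integrable_comp_of_finite {μ : Measure Ω} [IsFiniteMeasure μ] {Y : Ω → S} (hY : Measurable Y)
    (g : S → ℝ) : Integrable (fun ω => g (Y ω)) μ :=
  Integrable.of_bound ((measurable_of_finite g).comp hY).aestronglyMeasurable (supAbs g)
    (.of_forall fun _ => abs_le_supAbs g _)

variable (hκ : IsMarkovFamily T κ P)
include hκ

/-- The Markov property says that the transition probability is the conditional expectation of the
later indicator given the past; a bounded past-measurable weight can then be pulled out. -/
theorem IsMarkovFamily.integral_mul_single (i : S) {s t : ℝ≥0} (k : S) {G : Ω → ℝ} {C : ℝ}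
    (hG : Measurable[past κ s] G) (hC : ∀ ω, |G ω| ≤ C) :
    ∫ ω, G ω * (Pi.single k 1 : S → ℝ) (κ (s + t) ω) ∂(P i) =
      ∫ ω, G ω * NormedSpace.exp ((t : ℝ) • T) (κ s ω) k ∂(P i) := by
  have := hκ.isProb i
  have hle : past κ s ≤ _ := past_le hκ.measurable s
  set f : Ω → ℝ := fun ω => (Pi.single k 1 : S → ℝ) (κ (s + t) ω) with hf
  set g : Ω → ℝ := fun ω => NormedSpace.exp ((t : ℝ) • T) (κ s ω) k with hg
  have hfi : Integrable f (P i) := integrable_comp_of_finite (hκ.measurable _) _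
  have hgi : Integrable g (P i) := integrable_comp_of_finite (hκ.measurable _)
    fun a => NormedSpace.exp ((t : ℝ) • T) a k
  have hgm : Measurable[past κ s] g :=
    (measurable_of_finite fun a => NormedSpace.exp ((t : ℝ) • T) a k).comp
      (measurable_past κ le_rfl)
  have hce : g =ᵐ[P i] (P i)[f | past κ s] := by
    refine ae_eq_condExp_of_forall_setIntegral_eq hle hfi (fun _ _ _ => hgi.integrableOn) ?_
      hgm.stronglyMeasurable.aestronglyMeasurable
    intro A hA _
    -- Splitting according to the phase at time `s` reduces the claim to the events in the field
    -- `markov`.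
    have h1 : g = fun ω => ∑ a, (Pi.single a 1 : S → ℝ) (κ s ω) *
        NormedSpace.exp ((t : ℝ) • T) a k := by
      ext ω
      simp [hg, Pi.single_apply]
    have h2 : f = fun ω => ∑ a, ((Pi.single a 1 : S → ℝ) (κ s ω) *
        (Pi.single k 1 : S → ℝ) (κ (s + t) ω)) := by
      ext ω
      simp [hf, Pi.single_apply]
    have hsk : MeasurableSet {ω | κ (s + t) ω = k} := hκ.measurable _ (measurableSet_singleton k)
    have h3 : ∀ a : S, (fun ω => (Pi.single a 1 : S → ℝ) (κ s ω) *
        (Pi.single k 1 : S → ℝ) (κ (s + t) ω)) =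
        Set.indicator {ω | κ (s + t) ω = k} fun ω => (Pi.single a 1 : S → ℝ) (κ s ω) := by
      intro a
      ext ω
      by_cases h : κ (s + t) ω = k <;> simp [Set.indicator, Pi.single_apply, h]
    have h4 : ∀ a : S, Integrable (fun ω => (Pi.single a 1 : S → ℝ) (κ s ω)) (P i) :=
      fun a => integrable_comp_of_finite (hκ.measurable _) _
    rw [h1, h2, integral_finsetSum _ fun a _ => ((h4 a).mul_const _).integrableOn,
      integral_finsetSum _ fun a _ => ?_]
    · refine Finset.sum_congr rfl fun a _ => ?_
      rw [integral_mul_const, setIntegral_single (hκ.measurable _), h3,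
        setIntegral_indicator hsk, setIntegral_single (hκ.measurable _), ← hκ.markov i s t A hA a k]
      congr 1
      ext ω
      simp only [Set.mem_inter_iff, Set.mem_ofPred_eq]
      tauto
    · rw [h3]
      exact ((h4 a).indicator hsk).integrableOn
  have hGb : ∀ᵐ ω ∂(P i), ‖G ω‖ ≤ C := .of_forall hC
  have hGm : AEStronglyMeasurable G (P i) := (hG.mono hle le_rfl).aestronglyMeasurable
  have hpull := condExp_mul_of_stronglyMeasurable_left (μ := P i) hG.stronglyMeasurable
    (hfi.bdd_mul hGm hGb) hfi
  calc ∫ ω, G ω * f ω ∂(P i) = ∫ ω, ((P i)[G * f | past κ s]) ω ∂(P i) := by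
        rw [integral_condExp hle]; rfl
    _ = ∫ ω, G ω * g ω ∂(P i) := by
        refine integral_congr_ae ?_
        filter_upwards [hpull, hce] with ω h1 h2
        rw [h1, h2]; rfl

omit hκ in
/-- The Dynkin martingale of the indicator of a phase. -/
noncomputable def phaseMart (T : Matrix S S ℝ) (κ : ℝ≥0 → Ω → S) (j : S) (t : ℝ) (ω : Ω) : ℝ :=
  (Pi.single j 1 : S → ℝ) (κ t.toNNReal ω) - addFun (fun a => T a j) κ t ω

theorem IsMarkovFamily.measurable_uncurry_phase (g : S → ℝ) :
    Measurable fun p : ℝ × Ω => g (κ p.1.toNNReal p.2) :=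
  (measurable_of_finite g).comp (measurable_uncurry_of_rightCts hκ.measurable hκ.rightCts)

theorem IsMarkovFamily.measurable_uncurry_phaseMart (j : S) :
    Measurable fun p : ℝ × Ω => phaseMart T κ j p.1 p.2 :=
  (hκ.measurable_uncurry_phase _).sub
    (measurable_uncurry_addFun hκ.measurable hκ.rightCts _)

theorem IsMarkovFamily.abs_phaseMart_le (j : S) (t : ℝ) (ω : Ω) :
    |phaseMart T κ j t ω| ≤ 1 + supAbs (fun a => T a j) * |t| :=
  (abs_sub _ _).trans (add_le_add (abs_single_le _ _)
    (abs_addFun_le hκ.measurable hκ.rightCts _ _ _))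

/-- The weighted phase law `p k u = E[G 1{κ(u) = k}]` is `w exp((u - s)T)`, hence solves the forward
equation `p' = p T`. Integrating it from `s` to `t` and exchanging expectation with time gives the
martingale property. -/
theorem IsMarkovFamily.integral_mul_phaseMart_sub (i : S) {s t : ℝ≥0} (hst : s ≤ t) (j : S)
    {G : Ω → ℝ} {C : ℝ} (hG : Measurable[past κ s] G) (hC : ∀ ω, |G ω| ≤ C) :
    ∫ ω, G ω * (phaseMart T κ j t ω - phaseMart T κ j s ω) ∂(P i) = 0 := by
  have := hκ.isProb i
  have hle : past κ s ≤ _ := past_le hκ.measurable s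
  have hGm : Measurable G := hG.mono hle le_rfl
  have hGb : ∀ᵐ ω ∂(P i), ‖G ω‖ ≤ C := .of_forall hC
  have hint : ∀ (g : S → ℝ) (u : ℝ≥0), Integrable (fun ω => G ω * g (κ u ω)) (P i) := fun g u =>
    (integrable_comp_of_finite (hκ.measurable u) g).bdd_mul hGm.aestronglyMeasurable hGb
  set w : S → ℝ := fun a => ∫ ω, G ω * (Pi.single a 1 : S → ℝ) (κ s ω) ∂(P i) with hw
  set p : S → ℝ → ℝ := fun k u => ∑ a, w a * NormedSpace.exp ((u - s) • T) a k with hp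
  have hpk : ∀ k (u : ℝ), s ≤ u →
      ∫ ω, G ω * (Pi.single k 1 : S → ℝ) (κ u.toNNReal ω) ∂(P i) = p k u := by
    intro k u hu
    have hu0 : 0 ≤ u := s.2.trans hu
    have h1 : u.toNNReal = s + (u - s).toNNReal := by
      rw [← NNReal.coe_inj]; simp [hu0, Real.coe_toNNReal _ (sub_nonneg.2 hu)]
    rw [h1, hκ.integral_mul_single i k hG hC, Real.coe_toNNReal _ (sub_nonneg.2 hu)]
    have h2 : (fun ω => G ω * NormedSpace.exp ((u - s) • T) (κ s ω) k) = fun ω =>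
        ∑ a, (G ω * (Pi.single a 1 : S → ℝ) (κ s ω)) * NormedSpace.exp ((u - s) • T) a k := by
      ext ω; simp [Pi.single_apply]
    rw [h2, integral_finsetSum _ fun a _ => (hint _ _).mul_const _]
    simp only [integral_mul_const, hw, hp]
  have hpT : ∀ (u : ℝ), s ≤ u →
      ∫ ω, G ω * T (κ u.toNNReal ω) j ∂(P i) = ∑ b, p b u * T b j := by
    intro u hu
    have h2 : (fun ω => G ω * T (κ u.toNNReal ω) j) = fun ω =>
        ∑ b, (G ω * (Pi.single b 1 : S → ℝ) (κ u.toNNReal ω)) * T b j := by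
      ext ω; simp [Pi.single_apply]
    rw [h2, integral_finsetSum _ fun a _ => (hint _ _).mul_const _]
    simp only [integral_mul_const, hpk _ u hu]
  have hderiv : ∀ u : ℝ, HasDerivAt (p j) (∑ b, p b u * T b j) u := by
    intro u
    have h1 : ∀ a, HasDerivAt (fun u : ℝ => NormedSpace.exp ((u - s) • T) a j)
        ((NormedSpace.exp ((u - s) • T) * T) a j) u := fun a =>
      (hasDerivAt_exp_smul_apply T a j (u - s)).comp_sub_const u s
    have h2 := HasDerivAt.fun_sum (u := Finset.univ) fun a _ => (h1 a).const_mul (w a)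
    refine h2.congr_deriv ?_
    simp only [hp, Matrix.mul_apply, Finset.sum_mul, Finset.mul_sum, mul_assoc]
    exact Finset.sum_comm
  have hcont : ∀ k, Continuous (p k) := fun k => by
    refine continuous_finsetSum _ fun a _ => continuous_const.mul ?_
    exact (continuous_exp_smul_apply T a k).comp (continuous_id.sub continuous_const)
  have hFTC : ∫ u in (s : ℝ)..t, ∑ b, p b u * T b j = p j t - p j s := by
    refine intervalIntegral.integral_eq_sub_of_hasDerivAt (fun u _ => hderiv u) ?_
    exact (continuous_finsetSum _ fun b _ => (hcont b).mul continuous_const).intervalIntegrable _ _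
  have hswap : ∫ u in (s : ℝ)..t, ∫ ω, G ω * T (κ u.toNNReal ω) j ∂(P i) =
      ∫ ω, (∫ u in (s : ℝ)..t, G ω * T (κ u.toNNReal ω) j) ∂(P i) := by
    refine intervalIntegral_integral_swap ?_
    rw [Set.uIoc_of_le (NNReal.coe_le_coe.2 hst)]
    refine Integrable.of_bound (C := C * supAbs fun a => T a j) ?_ (.of_forall fun q => ?_)
    · exact ((hGm.comp measurable_snd).mul
        (hκ.measurable_uncurry_phase fun a => T a j)).aestronglyMeasurable
    · simp only [Function.uncurry, norm_mul]
      exact mul_le_mul (hC _) (abs_le_supAbs (fun a => T a j) _) (norm_nonneg _)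
        ((abs_nonneg _).trans (hC q.2))
  have hcongr : ∫ u in (s : ℝ)..t, ∫ ω, G ω * T (κ u.toNNReal ω) j ∂(P i) =
      ∫ u in (s : ℝ)..t, ∑ b, p b u * T b j := by
    refine intervalIntegral.integral_congr fun u hu => ?_
    rw [Set.uIcc_of_le (NNReal.coe_le_coe.2 hst)] at hu
    exact hpT u hu.1
  have hexp : ∀ ω, G ω * (phaseMart T κ j t ω - phaseMart T κ j s ω) =
      G ω * (Pi.single j 1 : S → ℝ) (κ t ω) - G ω * (Pi.single j 1 : S → ℝ) (κ s ω)
        - ∫ u in (s : ℝ)..t, G ω * T (κ u.toNNReal ω) j := by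
    intro ω
    rw [intervalIntegral.integral_const_mul,
      ← addFun_sub hκ.measurable hκ.rightCts (fun a => T a j) ω s t]
    simp only [phaseMart, Real.toNNReal_coe]
    ring
  have hJ : Integrable (fun ω => ∫ u in (s : ℝ)..t, G ω * T (κ u.toNNReal ω) j) (P i) := by
    have hmeas : Measurable fun ω => addFun (fun a => T a j) κ t ω - addFun (fun a => T a j) κ s ω :=
      ((measurable_past_addFun hκ.rightCts _ le_rfl).mono (past_le hκ.measurable t) le_rfl).sub
        ((measurable_past_addFun hκ.rightCts _ le_rfl).mono (past_le hκ.measurable s) le_rfl)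
    simp only [intervalIntegral.integral_const_mul,
      ← addFun_sub hκ.measurable hκ.rightCts (fun a => T a j) _ s t]
    exact (Integrable.of_bound hmeas.aestronglyMeasurable _ (.of_forall fun ω =>
      abs_addFun_sub_le hκ.measurable hκ.rightCts (fun a => T a j) ω s t)).bdd_mul
        hGm.aestronglyMeasurable hGb
  have ht := hpk j t (NNReal.coe_le_coe.2 hst)
  have hs := hpk j s le_rfl
  simp only [Real.toNNReal_coe] at ht hs
  simp only [hexp]
  rw [integral_sub ?_ hJ, integral_sub (hint _ _) (hint _ _), ← hswap,
    hcongr, hFTC, ht, hs, sub_self]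
  exact (hint _ _).sub (hint _ _)

end Markov

/-! ### Optional stopping in continuous time. -/

/-- Optional stopping for a bounded right-continuous martingale at a bounded stopping time. -/
theorem integral_stopped_eq {Ω : Type*} [mΩ : MeasurableSpace Ω] {μ : Measure Ω}
    [IsProbabilityMeasure μ] {ℱ : ℝ≥0 → MeasurableSpace Ω} (hle : ∀ s, ℱ s ≤ mΩ)
    {Z : ℝ≥0 → Ω → ℝ} {t : ℝ≥0} {C : ℝ} (hZm : ∀ s ≤ t, Measurable (Z s))
    (hZb : ∀ s ≤ t, ∀ ω, |Z s ω| ≤ C)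
    (hZr : ∀ ω s, ContinuousWithinAt (fun s => Z s ω) (Set.Ici s) s)
    (hZ : ∀ s s', s ≤ s' → s' ≤ t → ∀ A, MeasurableSet[ℱ s] A → ∫ ω in A, (Z s' ω - Z s ω) ∂μ = 0)
    {σ : Ω → ℝ≥0∞} (hσ : ∀ s : ℝ≥0, MeasurableSet[ℱ s] {ω | (s : ℝ≥0∞) < σ ω}) :
    ∫ ω, Z (min (σ ω) t).toNNReal ω ∂μ = ∫ ω, Z 0 ω ∂μ := by
  rcases eq_or_lt_of_le (zero_le (a := t)) with rfl | ht
  · simp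
  set ρ : Ω → ℝ≥0 := fun ω => (min (σ ω) t).toNNReal with hρ
  have hρc : ∀ ω, (ρ ω : ℝ≥0∞) = min (σ ω) t := fun ω =>
    ENNReal.coe_toNNReal (ne_top_of_le_ne_top ENNReal.coe_ne_top (min_le_right _ _))
  have hρt : ∀ ω, ρ ω ≤ t := fun ω => by
    rw [← ENNReal.coe_le_coe, hρc]; exact min_le_right _ _
  -- A grid of `[0, t]` with `n + 1` steps; `m n ω` is the index of the first grid point at or after
  -- the stopping time `ρ ω`.
  set g : ℕ → ℕ → ℝ≥0 := fun n k => k * t / (n + 1) with hg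
  set m : ℕ → Ω → ℕ := fun n ω => ⌈ρ ω * (n + 1) / t⌉₊ with hmdef
  have hmn : ∀ n ω, m n ω ≤ n + 1 := fun n ω => by
    rw [hmdef, Nat.ceil_le, div_le_iff₀ ht, mul_comm]
    push_cast
    gcongr
    exact hρt ω
  have hlt : ∀ n ω k, k < m n ω ↔ g n k < ρ ω := fun n ω k => by
    rw [hmdef, Nat.lt_ceil, lt_div_iff₀ ht, hg, div_lt_iff₀ (by positivity)]
  have hgt : ∀ n k, k < n + 1 → g n k < t := fun n k hk => by
    rw [hg, div_lt_iff₀ (by positivity), mul_comm]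
    gcongr
    exact_mod_cast hk
  have hgle : ∀ n k, k ≤ n + 1 → g n k ≤ t := fun n k hk => by
    rw [hg, div_le_iff₀ (by positivity), mul_comm]
    gcongr
    exact_mod_cast hk
  have hgmono : ∀ n k, g n k ≤ g n (k + 1) := fun n k => by
    simp only [hg]
    gcongr
    exact Nat.le_succ k
  -- Before the last grid point the cap at `t` is invisible, so whether the `k`-th increment is
  -- counted is known at its left end point. Each term of the telescoping sum below therefore has
  -- mean zero.
  have hset : ∀ n k, k < n + 1 → {ω | k < m n ω} = {ω | (g n k : ℝ≥0∞) < σ ω} := by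
    intro n k hk
    ext ω
    simp only [Set.mem_ofPred_eq]
    rw [hlt, ← ENNReal.coe_lt_coe, hρc, lt_min_iff, and_iff_left]
    exact_mod_cast hgt n k hk
  have htel : ∀ n ω, Z (g n (m n ω)) ω = Z 0 ω + ∑ k ∈ Finset.range (n + 1),
      Set.indicator {ω | k < m n ω} (fun ω => Z (g n (k + 1)) ω - Z (g n k) ω) ω := by
    intro n ω
    have h1 : ∑ k ∈ Finset.range (n + 1),
        Set.indicator {ω | k < m n ω} (fun ω => Z (g n (k + 1)) ω - Z (g n k) ω) ω =
        ∑ k ∈ Finset.range (m n ω), (Z (g n (k + 1)) ω - Z (g n k) ω) := by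
      simp only [Set.indicator, Set.mem_ofPred_eq]
      rw [← Finset.sum_filter]
      congr 1
      ext k
      simp only [Finset.mem_filter, Finset.mem_range]
      have := hmn n ω
      omega
    rw [h1, Finset.sum_range_sub (fun k => Z (g n k) ω)]
    simp [hg]
  have hmeasset : ∀ n k, k < n + 1 → MeasurableSet {ω | k < m n ω} := fun n k hk => by
    rw [hset n k hk]; exact hle _ _ (hσ _)
  have hZi : ∀ s ≤ t, Integrable (Z s) μ := fun s hs =>
    Integrable.of_bound (hZm s hs).aestronglyMeasurable C (.of_forall (hZb s hs))
  have hdi : ∀ n k, k < n + 1 → Integrable (fun ω => Z (g n (k + 1)) ω - Z (g n k) ω) μ :=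
    fun n k hk => (hZi _ (hgle _ _ hk)).sub (hZi _ (hgle _ _ hk.le))
  have hEn : ∀ n, ∫ ω, Z (g n (m n ω)) ω ∂μ = ∫ ω, Z 0 ω ∂μ := by
    intro n
    simp only [htel n]
    rw [integral_add (hZi 0 (zero_le (a := t))), integral_finsetSum, Finset.sum_eq_zero, add_zero]
    · intro k hk
      rw [Finset.mem_range] at hk
      rw [integral_indicator (hmeasset n k hk), hset n k hk]
      exact hZ _ _ (hgmono n k) (hgle _ _ hk) _ (hσ _)
    · exact fun k hk => (hdi n k (Finset.mem_range.1 hk)).indicator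
        (hmeasset n k (Finset.mem_range.1 hk))
    · exact integrable_finsetSum _ fun k hk => (hdi n k (Finset.mem_range.1 hk)).indicator
        (hmeasset n k (Finset.mem_range.1 hk))
  have hlim : Filter.Tendsto (fun n => ∫ ω, Z (g n (m n ω)) ω ∂μ) Filter.atTop
      (𝓝 (∫ ω, Z (ρ ω) ω ∂μ)) := by
    refine tendsto_integral_of_dominated_convergence (fun _ => C) (fun n => ?_)
      (integrable_const C) (fun n => .of_forall fun ω => hZb _ (hgle _ _ (hmn n ω)) ω)
      (.of_forall fun ω => ?_)
    · simp only [htel n]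
      exact ((hZi 0 (zero_le (a := t))).add (integrable_finsetSum _ fun k hk =>
        (hdi n k (Finset.mem_range.1 hk)).indicator
          (hmeasset n k (Finset.mem_range.1 hk)))).aestronglyMeasurable
    -- The discretised times exceed `ρ` by at most one mesh and never precede it, so
    -- right-continuity suffices.
    · refine (hZr ω (ρ ω)).tendsto.comp (tendsto_nhdsWithin_iff.2 ⟨?_, .of_forall fun n => ?_⟩)
      · have h1 : Filter.Tendsto (fun n : ℕ => ρ ω + t * (1 / ((n : ℝ≥0) + 1))) Filter.atTop
            (𝓝 (ρ ω + t * 0)) :=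
          tendsto_const_nhds.add (tendsto_const_nhds.mul tendsto_one_div_add_atTop_nhds_zero_nat)
        rw [mul_zero, add_zero] at h1
        refine tendsto_of_tendsto_of_tendsto_of_le_of_le tendsto_const_nhds h1
          (fun n => not_lt.1 fun h => lt_irrefl _ ((hlt n ω _).2 h)) fun n => ?_
        have h2 : (m n ω : ℝ≥0) ≤ ρ ω * (n + 1) / t + 1 := (Nat.ceil_lt_add_one (by positivity)).le
        have hn : (n : ℝ≥0) + 1 ≠ 0 := by positivity
        calc g n (m n ω) ≤ (ρ ω * (n + 1) / t + 1) * t / (n + 1) := by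
              simp only [hg]; gcongr
          _ = ρ ω + t * (1 / ((n : ℝ≥0) + 1)) := by
              field_simp
      · exact not_lt.1 fun h => lt_irrefl _ ((hlt n ω _).2 h)
  simp only [hEn] at hlim
  exact tendsto_nhds_unique hlim tendsto_const_nhds |>.trans rfl

/-! ### Dynkin's formula for a smooth adapted factor times a phase indicator. -/

section Product

set_option linter.unusedSectionVars false

variable {S Ω : Type*} [Fintype S] [DecidableEq S] [MeasurableSpace S]
    [MeasurableSingletonClass S] [MeasurableSpace Ω]
    {T : Matrix S S ℝ} {κ : ℝ≥0 → Ω → S} {P : S → Measure Ω}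

/-- `V` is an adapted process, bounded up to time `t₀`, with right derivative `V'`. -/
structure IsRightSmooth (κ : ℝ≥0 → Ω → S) (V V' : ℝ → Ω → ℝ) (t₀ : ℝ≥0) (C : ℝ) : Prop where
  cont : ∀ ω, Continuous fun u => V u ω
  deriv : ∀ ω u, 0 ≤ u → HasDerivWithinAt (fun u => V u ω) (V' u ω) (Set.Ioi u) u
  meas : Measurable fun p : ℝ × Ω => V' p.1 p.2
  adapted : ∀ u : ℝ≥0, Measurable[past κ u] (V u)
  adapted' : ∀ u : ℝ≥0, Measurable[past κ u] (V' u)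
  bound : ∀ ω (u : ℝ), 0 ≤ u → u ≤ t₀ → |V u ω| ≤ C
  bound' : ∀ ω (u : ℝ), 0 ≤ u → u ≤ t₀ → |V' u ω| ≤ C

/-- The generator applied to `V · 1{κ = j}`. -/
noncomputable def drift (T : Matrix S S ℝ) (κ : ℝ≥0 → Ω → S) (V V' : ℝ → Ω → ℝ) (j : S) (u : ℝ)
    (ω : Ω) : ℝ :=
  V' u ω * (Pi.single j 1 : S → ℝ) (κ u.toNNReal ω) + V u ω * T (κ u.toNNReal ω) j

/-- The Dynkin martingale of `V · 1{κ = j}`. -/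
noncomputable def dynkin (T : Matrix S S ℝ) (κ : ℝ≥0 → Ω → S) (V V' : ℝ → Ω → ℝ) (j : S) (t : ℝ)
    (ω : Ω) : ℝ :=
  V t ω * (Pi.single j 1 : S → ℝ) (κ t.toNNReal ω) - ∫ u in (0 : ℝ)..t, drift T κ V V' j u ω

theorem intervalIntegrable_of_abs_le {f : ℝ → ℝ} (hf : Measurable f) {a b C : ℝ} (hab : a ≤ b)
    (h : ∀ u, a ≤ u → u ≤ b → |f u| ≤ C) : IntervalIntegrable f volume a b := by
  rw [intervalIntegrable_iff_integrableOn_Ioc_of_le hab]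
  refine Integrable.of_bound hf.aestronglyMeasurable C ?_
  filter_upwards [ae_restrict_mem measurableSet_Ioc] with u hu
  exact h u hu.1.le hu.2

/-- Adaptedness controls `V` only at nonnegative times, hence the truncation `toNNReal`. -/
theorem IsRightSmooth.measurable_uncurry {V V' : ℝ → Ω → ℝ} {t₀ : ℝ≥0} {C : ℝ}
    (hV : IsRightSmooth κ V V' t₀ C) (hm : ∀ t, Measurable (κ t)) :
    Measurable fun p : ℝ × Ω => V p.1.toNNReal p.2 := by
  refine measurable_uncurry_of_continuous_of_measurable (u := fun (t : ℝ) ω => V t.toNNReal ω)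
    (fun ω => ?_) fun u => ?_
  · exact (hV.cont ω).comp (NNReal.continuous_coe.comp continuous_real_toNNReal)
  · exact (hV.adapted _).mono (past_le hm _) le_rfl

variable (hκ : IsMarkovFamily T κ P)
include hκ

variable {V V' : ℝ → Ω → ℝ} {t₀ : ℝ≥0} {C : ℝ}

theorem IsMarkovFamily.measurable_uncurry_drift (hV : IsRightSmooth κ V V' t₀ C) (j : S) :
    Measurable fun p : ℝ × Ω => V' p.1 p.2 * (Pi.single j 1 : S → ℝ) (κ p.1.toNNReal p.2) +
      V p.1.toNNReal p.2 * T (κ p.1.toNNReal p.2) j :=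
  (hV.meas.mul (hκ.measurable_uncurry_phase _)).add
    ((hV.measurable_uncurry hκ.measurable).mul (hκ.measurable_uncurry_phase fun a => T a j))

omit hκ in
theorem IsRightSmooth.abs_drift_le (hV : IsRightSmooth κ V V' t₀ C) (j : S) (ω : Ω) {u : ℝ}
    (h0 : 0 ≤ u) (h1 : u ≤ t₀) :
    |drift T κ V V' j u ω| ≤ C + C * supAbs fun a => T a j := by
  have hC : 0 ≤ C := (abs_nonneg _).trans (hV.bound ω u h0 h1)
  refine (abs_add_le _ _).trans ?_
  rw [abs_mul, abs_mul]
  refine add_le_add ?_ ?_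
  · exact (mul_le_mul (hV.bound' ω u h0 h1) (abs_single_le _ _) (abs_nonneg _) hC).trans_eq
      (mul_one C)
  · exact mul_le_mul (hV.bound ω u h0 h1) (abs_le_supAbs (fun a => T a j) _) (abs_nonneg _) hC

theorem IsMarkovFamily.measurable_drift_path (hV : IsRightSmooth κ V V' t₀ C) (j : S) (ω : Ω) :
    Measurable fun u => drift T κ V V' j u ω :=
  ((hV.meas.comp measurable_prodMk_right).mul (measurable_path hκ.measurable hκ.rightCts _ ω)).add
    ((hV.cont ω).measurable.mul (measurable_path hκ.measurable hκ.rightCts (fun a => T a j) ω))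

theorem IsMarkovFamily.intervalIntegrable_drift (hV : IsRightSmooth κ V V' t₀ C) (j : S) (ω : Ω)
    {s t : ℝ} (h0 : 0 ≤ s) (hst : s ≤ t) (h1 : t ≤ t₀) :
    IntervalIntegrable (fun u => drift T κ V V' j u ω) volume s t :=
  intervalIntegrable_of_abs_le (hκ.measurable_drift_path hV j ω) hst fun _ hu hu' =>
    hV.abs_drift_le j ω (h0.trans hu) (hu'.trans h1)

/-- Integration by parts, path by path. Only `V` and the compensator are differentiated, never the
indicator. Every term on the right is a quantity known at a time `u` multiplied by an increment of
`phaseMart` after `u`. -/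
theorem IsMarkovFamily.dynkin_sub (hV : IsRightSmooth κ V V' t₀ C) (j : S) (ω : Ω)
    {s t : ℝ} (h0 : 0 ≤ s) (hst : s ≤ t) (h1 : t ≤ t₀) :
    dynkin T κ V V' j t ω - dynkin T κ V V' j s ω =
      V s ω * (phaseMart T κ j t ω - phaseMart T κ j s ω) +
        ∫ u in s..t, V' u ω * (phaseMart T κ j t ω - phaseMart T κ j u ω) := by
  set J : ℝ → ℝ := fun u => addFun (fun a => T a j) κ u ω with hJ
  have hJc : Continuous J := continuous_addFun hκ.measurable hκ.rightCts _ ω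
  have hV'm : Measurable fun u => V' u ω := hV.meas.comp measurable_prodMk_right
  have hV'i : IntervalIntegrable (fun u => V' u ω) volume s t :=
    intervalIntegrable_of_abs_le hV'm hst fun _ hu hu' => hV.bound' ω _ (h0.trans hu) (hu'.trans h1)
  have hone : IntervalIntegrable (fun u => V' u ω * (Pi.single j 1 : S → ℝ) (κ u.toNNReal ω))
      volume s t := by
    refine intervalIntegrable_of_abs_le (C := C)
      (hV'm.mul (measurable_path hκ.measurable hκ.rightCts _ ω)) hst fun u hu hu' => ?_
    rw [Pi.mul_apply, abs_mul]
    exact (mul_le_of_le_one_right (abs_nonneg _) (abs_single_le _ _)).trans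
      (hV.bound' ω _ (h0.trans hu) (hu'.trans h1))
  have hVT : IntervalIntegrable (fun u => V u ω * T (κ u.toNNReal ω) j) volume s t :=
    (intervalIntegrable_path hκ.measurable hκ.rightCts (fun a => T a j) ω s t).continuousOn_mul
      (hV.cont ω).continuousOn
  have hVJ : IntervalIntegrable (fun u => V' u ω * J u) volume s t :=
    hV'i.mul_continuousOn hJc.continuousOn
  have hftcV : ∫ u in s..t, V' u ω = V t ω - V s ω :=
    intervalIntegral.integral_eq_sub_of_hasDeriv_right_of_le hst (hV.cont ω).continuousOn
      (fun u hu => hV.deriv ω u (h0.trans hu.1.le)) hV'i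
  have hftcVJ : ∫ u in s..t, (V' u ω * J u + V u ω * T (κ u.toNNReal ω) j) =
      V t ω * J t - V s ω * J s := by
    refine intervalIntegral.integral_eq_sub_of_hasDeriv_right_of_le hst
      ((hV.cont ω).mul hJc).continuousOn (fun u hu => ?_) (hVJ.add hVT)
    exact (hV.deriv ω u (h0.trans hu.1.le)).mul
      ((hasDerivWithinAt_addFun hκ.measurable hκ.rightCts (fun a => T a j) ω u).mono
        Set.Ioi_subset_Ici_self)
  rw [intervalIntegral.integral_add hVJ hVT] at hftcVJ
  have hd : (∫ u in (0 : ℝ)..t, drift T κ V V' j u ω) - ∫ u in (0 : ℝ)..s, drift T κ V V' j u ω =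
      (∫ u in s..t, V' u ω * (Pi.single j 1 : S → ℝ) (κ u.toNNReal ω)) +
        ∫ u in s..t, V u ω * T (κ u.toNNReal ω) j := by
    rw [intervalIntegral.integral_interval_sub_left
      (hκ.intervalIntegrable_drift hV j ω le_rfl (h0.trans hst) h1)
      (hκ.intervalIntegrable_drift hV j ω le_rfl h0 (hst.trans h1)),
      ← intervalIntegral.integral_add hone hVT]
    rfl
  have hr : ∫ u in s..t, V' u ω * (phaseMart T κ j t ω - phaseMart T κ j u ω) =
      (∫ u in s..t, V' u ω) * phaseMart T κ j t ω -
        ((∫ u in s..t, V' u ω * (Pi.single j 1 : S → ℝ) (κ u.toNNReal ω)) -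
          ∫ u in s..t, V' u ω * J u) := by
    rw [← intervalIntegral.integral_mul_const, ← intervalIntegral.integral_sub hone hVJ,
      ← intervalIntegral.integral_sub (hV'i.mul_const _) (hone.sub hVJ)]
    refine intervalIntegral.integral_congr fun u _ => ?_
    simp only [phaseMart, hJ]
    ring
  rw [hr, hftcV]
  simp only [dynkin, phaseMart]
  simp only [hJ] at hftcVJ
  linear_combination -hd - hftcVJ

/-- Both terms of `dynkin_sub` have mean zero on `A`: apply the weighted martingale property with
weight `1_A V(s)`, and with `1_A V'(u)` for each `u` after exchanging the integrals. -/
theorem IsMarkovFamily.setIntegral_dynkin_sub (hV : IsRightSmooth κ V V' t₀ C) (i j : S)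
    {s t : ℝ≥0} (hst : s ≤ t) (ht : t ≤ t₀) {A : Set Ω} (hA : MeasurableSet[past κ s] A) :
    ∫ ω in A, (dynkin T κ V V' j t ω - dynkin T κ V V' j s ω) ∂(P i) = 0 := by
  have := hκ.isProb i
  have hst' : (s : ℝ) ≤ t := NNReal.coe_le_coe.2 hst
  have ht' : (t : ℝ) ≤ t₀ := NNReal.coe_le_coe.2 ht
  have hAm : MeasurableSet A := past_le hκ.measurable s A hA
  set M : ℝ := 1 + supAbs (fun a => T a j) * t with hM
  have hD : ∀ u : ℝ, 0 ≤ u → u ≤ t → ∀ ω, |phaseMart T κ j u ω| ≤ M := by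
    intro u hu hut ω
    refine (hκ.abs_phaseMart_le j u ω).trans ?_
    rw [abs_of_nonneg hu]
    have := supAbs_nonneg fun a => T a j
    simp only [hM]
    gcongr
  have hDm : ∀ u : ℝ, Measurable (phaseMart T κ j u) := fun u =>
    (hκ.measurable_uncurry_phaseMart j).comp measurable_prodMk_left
  have hDD : ∀ u : ℝ, 0 ≤ u → u ≤ t → ∀ ω,
      |phaseMart T κ j t ω - phaseMart T κ j u ω| ≤ M + M := fun u hu hut ω =>
    (abs_sub _ _).trans (add_le_add (hD t t.coe_nonneg le_rfl ω) (hD u hu hut ω))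
  have hind : ∀ (u : ℝ≥0) (G : Ω → ℝ), s ≤ u → Measurable[past κ u] G →
      Measurable[past κ u] (A.indicator G) :=
    fun u G hsu hG => Measurable.indicator hG (past_mono hsu A hA)
  have hle : ∀ (G : Ω → ℝ) (c : ℝ), (∀ ω, |G ω| ≤ c) → ∀ ω, |A.indicator G ω| ≤ c := by
    intro G c hG ω
    by_cases h : ω ∈ A
    · simpa [h] using hG ω
    · simpa [h] using (abs_nonneg _).trans (hG ω)
  have hfirst : ∫ ω in A, V s ω * (phaseMart T κ j t ω - phaseMart T κ j s ω) ∂(P i) = 0 := by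
    rw [← integral_indicator hAm]
    simp only [Set.indicator_mul_left]
    exact hκ.integral_mul_phaseMart_sub i hst j (hind s _ le_rfl (hV.adapted s))
      (hle _ C fun ω => hV.bound ω s s.coe_nonneg (hst'.trans ht'))
  have hmid : ∀ u : ℝ, s ≤ u → u ≤ t →
      ∫ ω in A, V' u ω * (phaseMart T κ j t ω - phaseMart T κ j u ω) ∂(P i) = 0 := by
    intro u hu hut
    have hu0 : 0 ≤ u := s.coe_nonneg.trans hu
    lift u to ℝ≥0 using hu0
    rw [← integral_indicator hAm]
    simp only [Set.indicator_mul_left]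
    exact hκ.integral_mul_phaseMart_sub i (NNReal.coe_le_coe.1 hut) j
      (hind u _ (NNReal.coe_le_coe.1 hu) (hV.adapted' u))
      (hle _ C fun ω => hV.bound' ω u u.coe_nonneg (hut.trans ht'))
  have hint : Integrable (Function.uncurry fun (u : ℝ) (ω : Ω) =>
      V' u ω * (phaseMart T κ j t ω - phaseMart T κ j u ω))
      ((volume.restrict (Set.uIoc (s : ℝ) t)).prod ((P i).restrict A)) := by
    rw [Set.uIoc_of_le hst']
    refine Integrable.of_bound (C := C * (M + M)) ?_ ?_
    · refine (hV.meas.mul (Measurable.sub ?_ ?_)).aestronglyMeasurable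
      · exact (hDm t).comp measurable_snd
      · exact hκ.measurable_uncurry_phaseMart j
    · have h1 : ∀ᵐ p : ℝ × Ω ∂((volume.restrict (Set.Ioc (s : ℝ) t)).prod ((P i).restrict A)),
          p.1 ∈ Set.Ioc (s : ℝ) t :=
        Measure.quasiMeasurePreserving_fst.ae (ae_restrict_mem measurableSet_Ioc)
      filter_upwards [h1] with p hp
      have hp0 : 0 ≤ p.1 := s.coe_nonneg.trans hp.1.le
      simp only [Function.uncurry, norm_mul]
      exact mul_le_mul (hV.bound' _ _ hp0 (hp.2.trans ht')) (hDD _ hp0 hp.2 _) (norm_nonneg _)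
        ((abs_nonneg _).trans (hV.bound' p.2 _ hp0 (hp.2.trans ht')))
  have hfi : Integrable (fun ω => V s ω * (phaseMart T κ j t ω - phaseMart T κ j s ω))
      ((P i).restrict A) := by
    refine (Integrable.of_bound (C := M + M) ((hDm t).sub (hDm s)).aestronglyMeasurable
      (.of_forall fun ω => hDD s s.coe_nonneg hst' ω)).bdd_mul (c := C)
      ((hV.adapted s).mono (past_le hκ.measurable s) le_rfl).aestronglyMeasurable
      (.of_forall fun ω => hV.bound ω s s.coe_nonneg (hst'.trans ht'))
  have hgi : Integrable (fun ω => ∫ u in (s : ℝ)..t,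
      V' u ω * (phaseMart T κ j t ω - phaseMart T κ j u ω)) ((P i).restrict A) := by
    have := hint.integral_prod_right
    simpa only [Function.uncurry, intervalIntegral.integral_of_le hst', Set.uIoc_of_le hst']
      using this
  have hswap := intervalIntegral_integral_swap hint
  simp only [hκ.dynkin_sub hV j _ s.coe_nonneg hst' ht']
  rw [integral_add hfi hgi, hfirst, zero_add, ← hswap]
  refine (intervalIntegral.integral_congr fun u hu => ?_).trans intervalIntegral.integral_zero
  rw [Set.uIcc_of_le hst'] at hu
  exact hmid u hu.1 hu.2

/-- Dynkin's formula for `V · 1{κ = j}`, stopped at a bounded stopping time. -/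
theorem IsMarkovFamily.integral_stopped_dynkin (hV : IsRightSmooth κ V V' t₀ C)
    (i j : S) {σ : Ω → ℝ≥0∞} (hσ : ∀ s : ℝ≥0, MeasurableSet[past κ s] {ω | (s : ℝ≥0∞) < σ ω}) :
    ∫ ω, dynkin T κ V V' j (min (σ ω) t₀).toNNReal ω ∂(P i) =
      ∫ ω, dynkin T κ V V' j 0 ω ∂(P i) := by
  have := hκ.isProb i
  have hm := hκ.measurable_uncurry_drift hV j
  have hcd : ∀ (t : ℝ≥0) ω, ∫ u in (0 : ℝ)..t, drift T κ V V' j u ω =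
      ∫ u in (0 : ℝ)..t, (V' u ω * (Pi.single j 1 : S → ℝ) (κ u.toNNReal ω) +
        V u.toNNReal ω * T (κ u.toNNReal ω) j) := fun t ω => by
    refine intervalIntegral.integral_congr fun u hu => ?_
    rw [Set.uIcc_of_le t.coe_nonneg] at hu
    simp only [drift, Real.coe_toNNReal _ hu.1]
  -- The drift is controlled only up to `t₀`; freezing its integral there gives a process
  -- right-continuous at all times without changing it on `[0, t₀]`.
  have key := integral_stopped_eq (μ := P i) (ℱ := past κ) (past_le hκ.measurable)
    (Z := fun t ω => V t ω * (Pi.single j 1 : S → ℝ) (κ t ω) -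
      ∫ u in (0 : ℝ)..(min t t₀ : ℝ≥0), drift T κ V V' j u ω) (t := t₀)
    (C := C + (C + C * supAbs fun a => T a j) * t₀) ?_ ?_ ?_ ?_ hσ
  · simp only [min_eq_left (zero_le (a := t₀))] at key
    simp only [dynkin, Real.toNNReal_coe, Real.toNNReal_zero]
    refine Eq.trans (integral_congr_ae (.of_forall fun ω => ?_)) key
    have : (min (σ ω) t₀).toNNReal ≤ t₀ := by
      rw [← ENNReal.coe_le_coe, ENNReal.coe_toNNReal
        (ne_top_of_le_ne_top ENNReal.coe_ne_top (min_le_right _ _))]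
      exact min_le_right _ _
    simp only [min_eq_left this]
  · intro s hs
    refine (((hV.adapted s).mono (past_le hκ.measurable s) le_rfl).mul
      ((measurable_of_finite _).comp (hκ.measurable s))).sub ?_
    have h2 : StronglyMeasurable fun p : Ω × ℝ =>
        V' p.2 p.1 * (Pi.single j 1 : S → ℝ) (κ p.2.toNNReal p.1) +
          V p.2.toNNReal p.1 * T (κ p.2.toNNReal p.1) j :=
      (hm.comp measurable_swap).stronglyMeasurable
    simp only [hcd]
    simp only [intervalIntegral]
    exact (h2.integral_prod_right.sub h2.integral_prod_right).measurable
  · intro s hs ω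
    have hs' : (s : ℝ) ≤ t₀ := NNReal.coe_le_coe.2 hs
    have hC : 0 ≤ C := (abs_nonneg _).trans (hV.bound ω s s.coe_nonneg hs')
    refine (abs_sub _ _).trans (add_le_add ?_ ?_)
    · rw [abs_mul]
      exact (mul_le_of_le_one_right (abs_nonneg _) (abs_single_le _ _)).trans
        (hV.bound ω s s.coe_nonneg hs')
    · rw [min_eq_left hs]
      have h1 : ∀ u ∈ Set.uIoc (0 : ℝ) s, ‖drift T κ V V' j u ω‖ ≤ C + C * supAbs fun a => T a j := by
        intro u hu
        rw [Set.uIoc_of_le s.coe_nonneg] at hu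
        exact hV.abs_drift_le j ω hu.1.le (hu.2.trans hs')
      refine (intervalIntegral.norm_integral_le_of_norm_le_const h1).trans ?_
      rw [sub_zero, abs_of_nonneg s.coe_nonneg]
      have := supAbs_nonneg fun a => T a j
      gcongr
  · intro ω s
    refine ContinuousWithinAt.sub (ContinuousWithinAt.mul ?_ ?_) ?_
    · exact ((hV.cont ω).comp NNReal.continuous_coe).continuousWithinAt
    · refine (tendsto_const_nhds (x := (Pi.single j 1 : S → ℝ) (κ s ω))).congr' ?_
      filter_upwards [hκ.rightCts ω s] with u hu
      rw [hu]
    · have h1 : ContinuousOn (fun b => ∫ u in (0 : ℝ)..b, drift T κ V V' j u ω)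
          (Set.uIcc 0 (t₀ : ℝ)) :=
        intervalIntegral.continuousOn_primitive_interval
          ((intervalIntegrable_iff_integrableOn_Icc_of_le t₀.coe_nonneg).1
            (hκ.intervalIntegrable_drift hV j ω le_rfl t₀.coe_nonneg le_rfl) |>.mono_set
              (Set.uIcc_of_le t₀.coe_nonneg).le)
      have h2 : Continuous fun s : ℝ≥0 => ((min s t₀ : ℝ≥0) : ℝ) :=
        NNReal.continuous_coe.comp (continuous_id.min continuous_const)
      refine (h1.comp_continuous h2 fun s => ?_).continuousWithinAt
      rw [Set.uIcc_of_le t₀.coe_nonneg]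
      exact ⟨(min s t₀).coe_nonneg, NNReal.coe_le_coe.2 (min_le_right _ _)⟩
  · intro s s' hss hs' A hA
    simp only [min_eq_left hs', min_eq_left (hss.trans hs')]
    have := hκ.setIntegral_dynkin_sub hV i j hss hs' hA
    simpa only [dynkin, Real.toNNReal_coe] using this

end Product

/-! ### The return time: attainment, positivity of the level before it, and the stopping property.
-/

section Return

set_option linter.unusedSectionVars false

variable {S Ω : Type*} [Fintype S] [MeasurableSpace S] [MeasurableSingletonClass S]

theorem exists_path_eq_start {κ : ℝ≥0 → Ω → S} (hr : ∀ ω t, ∀ᶠ s in 𝓝[≥] t, κ s ω = κ t ω) (ω : Ω) :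
    ∃ ε : ℝ, 0 < ε ∧ ∀ u : ℝ, u < ε → κ u.toNNReal ω = κ 0 ω := by
  have h := eventually_path_eq hr ω 0
  rw [Real.toNNReal_zero, Filter.eventually_iff, mem_nhdsGE_iff_exists_Ico_subset] at h
  obtain ⟨ε, hε, h⟩ := h
  refine ⟨ε, hε, fun u hu => ?_⟩
  rcases le_total 0 u with h0 | h0
  · exact h ⟨h0, hu⟩
  · rw [Real.toNNReal_of_nonpos h0]

theorem addFun_eq_mul {κ : ℝ≥0 → Ω → S} {ω : Ω} {ε : ℝ}
    (h : ∀ u : ℝ, u < ε → κ u.toNNReal ω = κ 0 ω) (g : S → ℝ) {t : ℝ} (h0 : 0 ≤ t) (ht : t < ε) :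
    addFun g κ t ω = g (κ 0 ω) * t := by
  rw [addFun, intervalIntegral.integral_congr (g := fun _ => g (κ 0 ω))]
  · simp [mul_comm]
  · intro u hu
    rw [Set.uIcc_of_le h0] at hu
    simp only [h u (hu.2.trans_lt ht)]

variable {m : MeasurableSpace Ω} {κ : ℝ≥0 → Ω → S} (c : S → ℝ)
  (hm : ∀ t, Measurable (κ t)) (hr : ∀ ω t, ∀ᶠ s in 𝓝[≥] t, κ s ω = κ t ω)
include hm hr

omit hm hr in
theorem le_returnTime {ω : Ω} {s : ℝ≥0∞}
    (h : ∀ t : ℝ≥0, 0 < t → addFun c κ t ω = 0 → s ≤ t) : s ≤ returnTime c κ ω :=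
  le_iInf₂ fun t ht => h t ht.1 ht.2

omit hm hr in
theorem returnTime_le {ω : Ω} {t : ℝ≥0} (h0 : 0 < t) (h : addFun c κ t ω = 0) :
    returnTime c κ ω ≤ t :=
  iInf₂_le t (show 0 < t ∧ level c κ t ω = 0 from ⟨h0, h⟩)

omit hm in
theorem exists_addFun_eq_mul (ω : Ω) :
    ∃ ε : ℝ, 0 < ε ∧ ∀ t : ℝ, 0 ≤ t → t ≤ ε → addFun c κ t ω = c (κ 0 ω) * t := by
  obtain ⟨ε, hε, h⟩ := exists_path_eq_start hr ω
  exact ⟨ε / 2, by positivity, fun t h0 ht => addFun_eq_mul h c h0 (by linarith)⟩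

theorem returnTime_pos {ω : Ω} (hup : 0 < c (κ 0 ω)) : 0 < returnTime c κ ω := by
  obtain ⟨ε, hε, h⟩ := exists_addFun_eq_mul c hr ω
  refine lt_of_lt_of_le (b := ENNReal.ofReal ε) (by simpa using hε)
    (le_returnTime c fun t ht h0 => ?_)
  rw [← ENNReal.ofReal_coe_nnreal]
  refine ENNReal.ofReal_le_ofReal (le_of_not_ge fun hle => ?_)
  rw [h t t.coe_nonneg hle] at h0
  have := mul_pos hup (NNReal.coe_pos.2 ht)
  linarith

/-- The level rises linearly at first; a later nonpositive value would force a zero in between, by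
the intermediate value theorem. -/
theorem addFun_pos_of_lt_returnTime {ω : Ω} (hup : 0 < c (κ 0 ω)) {t : ℝ≥0} (h0 : 0 < t)
    (ht : (t : ℝ≥0∞) < returnTime c κ ω) : 0 < addFun c κ t ω := by
  by_contra hneg
  obtain ⟨ε, hε, h⟩ := exists_addFun_eq_mul c hr ω
  set δ : ℝ := min ε t with hδ
  have hδ0 : 0 < δ := lt_min hε (NNReal.coe_pos.2 h0)
  have h1 : 0 < addFun c κ δ ω := by
    rw [h δ hδ0.le (min_le_left _ _)]; exact mul_pos hup hδ0
  obtain ⟨u, hu, hu0⟩ := intermediate_value_Icc' (min_le_right ε (t : ℝ))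
    (continuous_addFun hm hr c ω).continuousOn ⟨not_lt.1 hneg, h1.le⟩
  have hu' : 0 < u := hδ0.trans_le hu.1
  lift u to ℝ≥0 using hu'.le
  have h2 := returnTime_le c (ω := ω) (NNReal.coe_pos.1 hu') hu0
  have h3 : (u : ℝ≥0∞) ≤ t := ENNReal.coe_le_coe.2 (NNReal.coe_le_coe.1 hu.2)
  exact absurd (h2.trans h3) (not_le.2 ht)

/-- The infimum is attained by continuity: a nonzero level at `τ` would stay nonzero on some `[τ,
v)`, pushing the infimum up to `v`. -/
theorem addFun_returnTime {ω : Ω} (ht : returnTime c κ ω ≠ ∞) :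
    addFun c κ (returnTime c κ ω).toNNReal ω = 0 := by
  by_contra hne
  set t := (returnTime c κ ω).toNNReal with htd
  have htc : (t : ℝ≥0∞) = returnTime c κ ω := ENNReal.coe_toNNReal ht
  have hc : Continuous fun u : ℝ≥0 => addFun c κ u ω :=
    (continuous_addFun hm hr c ω).comp NNReal.continuous_coe
  obtain ⟨v, hv, hv'⟩ := exists_Ico_subset_of_mem_nhds
    ((isOpen_ne_fun hc continuous_const).mem_nhds hne) ⟨t + 1, by simp⟩
  have : (v : ℝ≥0∞) ≤ returnTime c κ ω := le_returnTime c fun u hu0 hu => by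
    rw [ENNReal.coe_le_coe]
    by_contra hlt
    have h1 : t ≤ u := by
      rw [← ENNReal.coe_le_coe, htc]; exact returnTime_le c hu0 hu
    exact hv' ⟨h1, not_le.1 hlt⟩ hu
  rw [← htc, ENNReal.coe_le_coe] at this
  exact absurd hv (not_lt.2 this)

/-- Positivity on `(0, s]` is replaced by a linear lower bound on `[0, s]`, which is a closed
condition in `r` and can be tested on a countable dense set. The bound is linear because the level
vanishes at `0`: the initial slope provides it near `0`, compactness away from `0`. -/
theorem lt_returnTime_iff {ω : Ω} (hup : 0 < c (κ 0 ω)) (s : ℝ≥0) :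
    (s : ℝ≥0∞) < returnTime c κ ω ↔ ∃ n : ℕ, ∀ r : ℝ≥0, r ≤ s → r / (n + 1 : ℝ) ≤ addFun c κ r ω := by
  constructor
  · intro hs
    obtain ⟨ε, hε, h⟩ := exists_addFun_eq_mul c hr ω
    obtain ⟨b, hb, hmin⟩ : ∃ b : ℝ, 0 < b ∧ ∀ r : ℝ, ε ≤ r → r ≤ s → b ≤ addFun c κ r ω := by
      rcases le_or_gt ε s with hle | hlt
      · obtain ⟨x, hx, hxm⟩ := isCompact_Icc.exists_isMinOn (Set.nonempty_Icc.2 hle)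
          (continuous_addFun hm hr c ω).continuousOn
        have hx0 : 0 < x := hε.trans_le hx.1
        lift x to ℝ≥0 using hx0.le
        refine ⟨_, addFun_pos_of_lt_returnTime c hm hr hup (t := x) (by exact_mod_cast hx0) ?_,
          fun r h1 h2 => hxm ⟨h1, h2⟩⟩
        exact lt_of_le_of_lt (ENNReal.coe_le_coe.2 (NNReal.coe_le_coe.1 hx.2)) hs
      · exact ⟨1, one_pos, fun r h1 h2 => absurd (hlt.trans_le h1) (not_lt.2 h2)⟩
    obtain ⟨n, hn⟩ := exists_nat_gt (max (s / b) (1 / c (κ 0 ω)))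
    have hn0 : (0 : ℝ) < n + 1 := by positivity
    refine ⟨n, fun r hrs => ?_⟩
    rw [div_le_iff₀ hn0]
    rcases le_total (r : ℝ) ε with hle | hle
    · rw [h r r.coe_nonneg hle]
      have h1 : 1 / c (κ 0 ω) < n + 1 := (le_max_right _ _).trans_lt (hn.trans (lt_add_one _))
      rw [div_lt_iff₀ hup] at h1
      nlinarith [r.coe_nonneg]
    · have h1 : s / b < n + 1 := (le_max_left _ _).trans_lt (hn.trans (lt_add_one _))
      rw [div_lt_iff₀ hb] at h1
      have h2 := hmin r hle (NNReal.coe_le_coe.2 hrs)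
      have h3 : (r : ℝ) ≤ s := NNReal.coe_le_coe.2 hrs
      nlinarith
  · rintro ⟨n, hn⟩
    by_contra hle
    have hle := not_lt.1 hle
    have hne : returnTime c κ ω ≠ ∞ := ne_top_of_le_ne_top ENNReal.coe_ne_top hle
    have h0 := addFun_returnTime c hm hr hne
    have h1 := hn (returnTime c κ ω).toNNReal (by
      rw [← ENNReal.coe_le_coe, ENNReal.coe_toNNReal hne]; exact hle)
    rw [h0] at h1
    have h2 : 0 < ((returnTime c κ ω).toNNReal : ℝ) :=
      NNReal.coe_pos.2 (ENNReal.toNNReal_pos (returnTime_pos c hm hr hup).ne' hne)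
    have : 0 < ((returnTime c κ ω).toNNReal : ℝ) / (n + 1 : ℝ) := by positivity
    linarith

omit hm hr in
/-- The first return time to level `0` on the event that the chain starts in an up phase, and `0`
otherwise. -/
noncomputable def upReturn {S Ω : Type*} (c : S → ℝ) (κ : ℝ≥0 → Ω → S) (ω : Ω) : ℝ≥0∞ :=
  open Classical in if 0 < c (κ 0 ω) then returnTime c κ ω else 0

omit hm hr in
theorem upReturn_of_pos {ω : Ω} (hup : 0 < c (κ 0 ω)) : upReturn c κ ω = returnTime c κ ω :=
  if_pos hup

omit hm hr in
theorem upReturn_of_not_pos {ω : Ω} (hup : ¬ 0 < c (κ 0 ω)) : upReturn c κ ω = 0 :=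
  if_neg hup

/-- The filtration is not completed, so the event must be described for every path. This is why
`upReturn` is set to `0` when the start is not in an up phase, where the criterion for `returnTime`
is not available. -/
theorem measurableSet_lt_upReturn (s : ℝ≥0) :
    MeasurableSet[past κ s] {ω | (s : ℝ≥0∞) < upReturn c κ ω} := by
  have key : {ω | (s : ℝ≥0∞) < upReturn c κ ω} = {ω | 0 < c (κ 0 ω)} ∩ ⋃ n : ℕ, ⋂ k : ℕ,
      {ω | ((min (TopologicalSpace.denseSeq ℝ≥0 k) s : ℝ≥0) : ℝ) / (n + 1 : ℝ) ≤
        addFun c κ (min (TopologicalSpace.denseSeq ℝ≥0 k) s : ℝ≥0) ω} := by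
    ext ω
    simp only [Set.mem_ofPred_eq, Set.mem_inter_iff, Set.mem_iUnion, Set.mem_iInter]
    by_cases hup : 0 < c (κ 0 ω)
    · rw [upReturn_of_pos c hup, lt_returnTime_iff c hm hr hup, and_iff_right hup]
      -- Taking the minimum with `s` keeps the dense times inside `[0, s]`, and closedness extends
      -- the inequality from them to every `r ≤ s`.
      refine exists_congr fun n => ⟨fun h k => h _ (min_le_right _ _), fun h r hrs => ?_⟩
      have hcl : IsClosed {q : ℝ≥0 | ((min q s : ℝ≥0) : ℝ) / (n + 1 : ℝ) ≤
          addFun c κ (min q s : ℝ≥0) ω} := by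
        have h2 : Continuous fun q : ℝ≥0 => ((min q s : ℝ≥0) : ℝ) :=
          NNReal.continuous_coe.comp (continuous_id.min continuous_const)
        exact isClosed_le (h2.div_const _) ((continuous_addFun hm hr c ω).comp h2)
      have hall := (hcl.closure_subset_iff.2 (Set.range_subset_iff.2 h))
        ((TopologicalSpace.denseRange_denseSeq ℝ≥0) r)
      simpa only [Set.mem_ofPred_eq, min_eq_left hrs] using hall
    · simp [upReturn_of_not_pos c hup, hup]
  rw [key]
  refine MeasurableSet.inter ?_ (MeasurableSet.iUnion fun n => MeasurableSet.iInter fun k => ?_)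
  · exact (measurable_past κ (zero_le (a := s))) (Set.toFinite {a | 0 < c a}).measurableSet
  · exact (measurable_past_addFun hr c (NNReal.coe_le_coe.2 (min_le_right _ _))) measurableSet_Ici

theorem measurable_upReturn : Measurable (upReturn c κ) := by
  refine measurable_of_Ioi fun a => ?_
  rcases eq_or_ne a ∞ with rfl | ha
  · simp
  · lift a to ℝ≥0 using ha
    exact past_le hm a _ (measurableSet_lt_upReturn c hm hr a)

theorem addFun_upReturn {ω : Ω} (h : upReturn c κ ω ≠ ∞) :
    addFun c κ (upReturn c κ ω).toNNReal ω = 0 := by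
  by_cases hup : 0 < c (κ 0 ω)
  · rw [upReturn_of_pos c hup] at h ⊢
    exact addFun_returnTime c hm hr h
  · simp [upReturn_of_not_pos c hup, addFun_zero]

theorem addFun_nonneg_of_le_upReturn {ω : Ω} {t : ℝ≥0} (h : (t : ℝ≥0∞) ≤ upReturn c κ ω) :
    0 ≤ addFun c κ t ω := by
  rcases eq_or_lt_of_le h with h | h
  · have := addFun_upReturn c hm hr (ω := ω) (h ▸ ENNReal.coe_ne_top)
    rw [← h, ENNReal.toNNReal_coe] at this
    exact this.ge
  · have hup : 0 < c (κ 0 ω) := by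
      by_contra hup
      simp [upReturn_of_not_pos c hup] at h
    rcases eq_or_lt_of_le (zero_le (a := t)) with rfl | h0
    · simp [addFun_zero]
    · rw [upReturn_of_pos c hup] at h
      exact (addFun_pos_of_lt_returnTime c hm hr hup h0 h).le

end Return

/-! ### The test function `e^{-qu} (x - X(u))⁺` and its right derivative. -/

section TestFunction

set_option linter.unusedSectionVars false

variable {S Ω : Type*} [Fintype S] [MeasurableSpace S] [MeasurableSingletonClass S]

/-- The distance of the fluid level below `x`. -/
noncomputable def shortfall (c : S → ℝ) (κ : ℝ≥0 → Ω → S) (x u : ℝ) (ω : Ω) : ℝ :=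
  max (x - addFun c κ u ω) 0

open Classical in
/-- The negative of the right derivative of `shortfall`. -/
noncomputable def shortfallRate (c : S → ℝ) (κ : ℝ≥0 → Ω → S) (x u : ℝ) (ω : Ω) : ℝ :=
  if addFun c κ u ω < x ∨ (addFun c κ u ω = x ∧ c (κ u.toNNReal ω) < 0) then
    c (κ u.toNNReal ω) else 0

theorem eventually_pos_slope {f : ℝ → ℝ} {f' u : ℝ} (h : HasDerivWithinAt f f' (Set.Ioi u) u)
    (hf : 0 < f') : ∀ᶠ v in 𝓝[>] u, f u < f v := by
  have h1 := (hasDerivWithinAt_iff_tendsto_slope' (by simp)).1 h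
  filter_upwards [h1.eventually (lt_mem_nhds hf), self_mem_nhdsWithin] with v hv huv
  rw [slope_def_field, lt_div_iff₀ (sub_pos.2 huv)] at hv
  linarith

variable {m : MeasurableSpace Ω} {κ : ℝ≥0 → Ω → S} {c : S → ℝ} (hc : ∀ i, c i ≠ 0)
  (hm : ∀ t, Measurable (κ t)) (hr : ∀ ω t, ∀ᶠ s in 𝓝[≥] t, κ s ω = κ t ω)
include hm hr

theorem hasDerivWithinAt_addFun_Ioi (g : S → ℝ) (ω : Ω) (t : ℝ) :
    HasDerivWithinAt (fun t => addFun g κ t ω) (g (κ t.toNNReal ω)) (Set.Ioi t) t :=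
  (hasDerivWithinAt_addFun hm hr g ω t).mono Set.Ioi_subset_Ici_self

-- As no rate vanishes, the level moves strictly to one side immediately after every time.
include hc in
theorem eventually_addFun_lt_or_gt (ω : Ω) (u : ℝ) :
    (0 < c (κ u.toNNReal ω) ∧ ∀ᶠ v in 𝓝[>] u, addFun c κ u ω < addFun c κ v ω) ∨
      (c (κ u.toNNReal ω) < 0 ∧ ∀ᶠ v in 𝓝[>] u, addFun c κ v ω < addFun c κ u ω) := by
  have h := hasDerivWithinAt_addFun_Ioi hm hr c ω u
  rcases lt_or_gt_of_ne (hc (κ u.toNNReal ω)) with hneg | hpos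
  · refine .inr ⟨hneg, ?_⟩
    filter_upwards [eventually_pos_slope h.fun_neg (neg_pos.2 hneg)] with v hv
    exact neg_lt_neg_iff.1 hv
  · exact .inl ⟨hpos, eventually_pos_slope h hpos⟩

-- The kink at `X(u) = x` is harmless: only a right derivative is needed, and the path leaves level
-- `x` at once, upwards or downwards according to the sign of the current rate.
include hc in
theorem hasDerivWithinAt_shortfall (x : ℝ) (ω : Ω) (u : ℝ) :
    HasDerivWithinAt (fun u => shortfall c κ x u ω) (-shortfallRate c κ x u ω) (Set.Ioi u) u := by
  have h := hasDerivWithinAt_addFun_Ioi hm hr c ω u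
  have hcont : ContinuousWithinAt (fun u => addFun c κ u ω) (Set.Ioi u) u :=
    (continuous_addFun hm hr c ω).continuousWithinAt
  have hbelow : addFun c κ u ω ≤ x → (∀ᶠ v in 𝓝[>] u, addFun c κ v ω ≤ x) →
      HasDerivWithinAt (fun u => shortfall c κ x u ω) (-c (κ u.toNNReal ω)) (Set.Ioi u) u := by
    intro hu hv
    refine (h.const_sub x).congr_of_eventuallyEq ?_ (max_eq_left (by linarith))
    filter_upwards [hv] with v hv
    exact max_eq_left (by linarith)
  have habove : x ≤ addFun c κ u ω → (∀ᶠ v in 𝓝[>] u, x ≤ addFun c κ v ω) →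
      HasDerivWithinAt (fun u => shortfall c κ x u ω) 0 (Set.Ioi u) u := by
    intro hu hv
    refine (hasDerivWithinAt_const u (Set.Ioi u) (0 : ℝ)).congr_of_eventuallyEq ?_
      (max_eq_right (by linarith))
    filter_upwards [hv] with v hv
    exact max_eq_right (by linarith)
  rcases lt_trichotomy (addFun c κ u ω) x with hlt | heq | hgt
  · rw [shortfallRate, if_pos (.inl hlt)]
    exact hbelow hlt.le ((hcont.eventually (gt_mem_nhds hlt)).mono fun _ h => h.le)
  · rcases eventually_addFun_lt_or_gt hc hm hr ω u with ⟨hpos, hv⟩ | ⟨hneg, hv⟩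
    · rw [shortfallRate, if_neg (by rintro (h | h) <;> linarith), neg_zero]
      exact habove heq.ge (hv.mono fun v hv => heq ▸ hv.le)
    · rw [shortfallRate, if_pos (.inr ⟨heq, hneg⟩)]
      exact hbelow heq.le (hv.mono fun v hv => heq ▸ hv.le)
  · rw [shortfallRate, if_neg (by rintro (h | h) <;> linarith), neg_zero]
    exact habove hgt.le ((hcont.eventually (lt_mem_nhds hgt)).mono fun _ h => h.le)

include hc in
/-- The fluid spends no time at a fixed level. -/
theorem volume_level_eq (x : ℝ) (ω : Ω) : volume {u : ℝ | addFun c κ u ω = x} = 0 := by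
  refine Set.Countable.measure_zero ?_ _
  -- Each time at level `x` is isolated from the right among such times, and a set of reals has only
  -- countably many points of this kind.
  refine Set.Countable.mono (fun u hu => ?_)
    (countable_setOfPred_isolated_right_within (s := {u : ℝ | addFun c κ u ω = x}))
  refine ⟨hu, ?_⟩
  rw [← Filter.empty_mem_iff_bot, Set.inter_comm, nhdsWithin_inter', Filter.mem_inf_principal]
  rcases eventually_addFun_lt_or_gt hc hm hr ω u with ⟨-, hv⟩ | ⟨-, hv⟩
  · filter_upwards [hv] with v hv hvx
    have : addFun c κ u ω = x := hu
    have : addFun c κ v ω = x := hvx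
    linarith
  · filter_upwards [hv] with v hv hvx
    have : addFun c κ u ω = x := hu
    have : addFun c κ v ω = x := hvx
    linarith

theorem measurable_uncurry_shortfall (x : ℝ) :
    Measurable fun p : ℝ × Ω => shortfall c κ x p.1 p.2 :=
  (measurable_const.sub (measurable_uncurry_addFun hm hr c)).max measurable_const

theorem measurable_uncurry_shortfallRate (x : ℝ) :
    Measurable fun p : ℝ × Ω => shortfallRate c κ x p.1 p.2 := by
  have h1 := measurable_uncurry_addFun hm hr c
  have h2 : Measurable fun p : ℝ × Ω => c (κ p.1.toNNReal p.2) :=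
    (measurable_of_finite c).comp (measurable_uncurry_of_rightCts hm hr)
  refine Measurable.ite ?_ h2 measurable_const
  exact (measurableSet_lt h1 measurable_const).union
    ((measurableSet_eq_fun h1 measurable_const).inter (measurableSet_lt h2 measurable_const))

omit hm hr in
theorem abs_shortfallRate_le (x u : ℝ) (ω : Ω) : |shortfallRate c κ x u ω| ≤ supAbs c := by
  unfold shortfallRate
  split_ifs
  · exact abs_le_supAbs c _
  · simpa using supAbs_nonneg c

theorem abs_shortfall_le (x : ℝ) (ω : Ω) {u t : ℝ} (h0 : 0 ≤ u) (ht : u ≤ t) :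
    |shortfall c κ x u ω| ≤ |x| + supAbs c * t := by
  have h1 := abs_addFun_le hm hr c ω u
  have h2 : supAbs c * |u| ≤ supAbs c * t := by
    rw [abs_of_nonneg h0]; exact mul_le_mul_of_nonneg_left ht (supAbs_nonneg c)
  rw [shortfall, abs_of_nonneg (le_max_right _ _)]
  refine max_le ?_ ?_
  · linarith [le_abs_self x, neg_abs_le (addFun c κ u ω)]
  · linarith [abs_nonneg x, abs_nonneg (addFun c κ u ω)]

include hc in
theorem isRightSmooth_shortfall {q : ℝ} (hq : 0 ≤ q) (x : ℝ) (t₀ : ℝ≥0) :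
    IsRightSmooth κ (fun u ω => Real.exp (-(q * u)) * shortfall c κ x u ω)
      (fun u ω => Real.exp (-(q * u)) * (-(q * shortfall c κ x u ω) - shortfallRate c κ x u ω))
      t₀ ((1 + q) * (|x| + supAbs c * t₀) + supAbs c) := by
  have hmX : ∀ u : ℝ≥0, Measurable[past κ u] fun ω => addFun c κ u ω := fun u =>
    measurable_past_addFun hr c le_rfl
  have hms : ∀ u : ℝ≥0, Measurable[past κ u] fun ω => shortfall c κ x u ω := fun u =>
    Measurable.max (Measurable.const_sub (hmX u) x) measurable_const
  have hmr : ∀ u : ℝ≥0, Measurable[past κ u] fun ω => shortfallRate c κ x u ω := fun u => by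
    have h2 : Measurable[past κ u] fun ω => c (κ (u : ℝ).toNNReal ω) := by
      rw [Real.toNNReal_coe]
      exact (measurable_of_finite c).comp (measurable_past κ le_rfl)
    refine Measurable.ite ?_ h2 measurable_const
    exact ((hmX u) measurableSet_Iio).union
      (((hmX u) (measurableSet_singleton x)).inter (h2 measurableSet_Iio))
  have hexp : ∀ u : ℝ, 0 ≤ u → |Real.exp (-(q * u))| ≤ 1 := fun u hu => by
    rw [abs_of_pos (Real.exp_pos _), Real.exp_le_one_iff]
    have := mul_nonneg hq hu
    linarith
  have hB : 0 ≤ |x| + supAbs c * t₀ :=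
    add_nonneg (abs_nonneg _) (mul_nonneg (supAbs_nonneg c) t₀.coe_nonneg)
  refine ⟨fun ω => ?_, fun ω u hu => ?_, ?_, fun u => ?_, fun u => ?_, fun ω u h0 h1 => ?_,
    fun ω u h0 h1 => ?_⟩
  · exact (by fun_prop : Continuous fun u : ℝ => Real.exp (-(q * u))).mul
      ((continuous_const.sub (continuous_addFun hm hr c ω)).max continuous_const)
  · have he : HasDerivAt (fun u : ℝ => Real.exp (-(q * u))) (Real.exp (-(q * u)) * -(q * 1)) u :=
      ((hasDerivAt_id u).const_mul q).neg.exp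
    refine (he.hasDerivWithinAt.mul (hasDerivWithinAt_shortfall hc hm hr x ω u)).congr_deriv ?_
    ring
  · refine Measurable.mul (by fun_prop) (Measurable.sub ?_ ?_)
    · exact ((measurable_uncurry_shortfall hm hr x).const_mul q).neg
    · exact measurable_uncurry_shortfallRate hm hr x
  · exact Measurable.const_mul (hms u) _
  · exact Measurable.const_mul (Measurable.sub (Measurable.neg (Measurable.const_mul (hms u) q))
      (hmr u)) _
  · rw [abs_mul]
    have h2 := abs_shortfall_le hm hr (c := c) x ω h0 h1
    have h3 := mul_le_mul (hexp u h0) h2 (abs_nonneg _) zero_le_one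
    nlinarith [supAbs_nonneg c]
  · rw [abs_mul]
    have h2 := abs_shortfall_le hm hr (c := c) x ω h0 h1
    have h4 : |-(q * shortfall c κ x u ω) - shortfallRate c κ x u ω| ≤
        q * (|x| + supAbs c * t₀) + supAbs c := by
      refine (abs_sub _ _).trans (add_le_add ?_ (abs_shortfallRate_le x u ω))
      rw [abs_neg, abs_mul, abs_of_nonneg hq]
      gcongr
    have h3 := mul_le_mul (hexp u h0) h4 (abs_nonneg _) zero_le_one
    nlinarith [supAbs_nonneg c]

end TestFunction

/-! ### The discounted occupation measure before the return. -/

section Occupation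

set_option linter.unusedSectionVars false

/-- The measure with density `e^{-qu}` on the positive half-line. -/
noncomputable def expLaw (q : ℝ) : Measure ℝ :=
  (volume.restrict (Set.Ioi 0)).withDensity fun u => ENNReal.ofReal (Real.exp (-(q * u)))

instance isFiniteMeasure_expLaw (q : ℝ) [hq : Fact (0 < q)] : IsFiniteMeasure (expLaw q) := by
  refine isFiniteMeasure_withDensity_ofReal ?_
  have := exp_neg_integrableOn_Ioi 0 hq.out
  simp only [neg_mul] at this
  exact this.2

instance sFinite_expLaw (q : ℝ) : SFinite (expLaw q) := by
  unfold expLaw; infer_instance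

theorem setIntegral_expLaw (q : ℝ) (f : ℝ → ℝ) {A : Set ℝ} (hA : MeasurableSet A) :
    ∫ u in A, f u ∂(expLaw q) = ∫ u in A ∩ Set.Ioi 0, Real.exp (-(q * u)) * f u := by
  have h1 : Measurable fun u : ℝ => ENNReal.ofReal (Real.exp (-(q * u))) := by fun_prop
  rw [expLaw, setIntegral_withDensity_eq_setIntegral_toReal_smul h1
    (.of_forall fun _ => ENNReal.ofReal_lt_top) f hA, Measure.restrict_restrict hA]
  simp only [ENNReal.toReal_ofReal (Real.exp_pos _).le, smul_eq_mul]

theorem ae_expLaw_pos (q : ℝ) : ∀ᵐ u ∂(expLaw q), 0 < u :=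
  (withDensity_absolutelyContinuous _ _).ae_le (ae_restrict_mem measurableSet_Ioi)

theorem ofReal_le_expLaw_Ioc (q : ℝ) (hq : 0 ≤ q) (y : ℝ) :
    ENNReal.ofReal (Real.exp (-(q * y)) * y) ≤ expLaw q (Set.Ioc 0 y) := by
  rw [expLaw, withDensity_apply _ measurableSet_Ioc, Measure.restrict_restrict measurableSet_Ioc]
  have h1 : Set.Ioc 0 y ∩ Set.Ioi 0 = Set.Ioc 0 y :=
    Set.inter_eq_left.2 fun u hu => hu.1
  rw [h1]
  calc ENNReal.ofReal (Real.exp (-(q * y)) * y)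
      = ∫⁻ _ in Set.Ioc 0 y, ENNReal.ofReal (Real.exp (-(q * y))) := by
        rw [setLIntegral_const, Real.volume_Ioc, sub_zero, ENNReal.ofReal_mul (Real.exp_pos _).le]
    _ ≤ _ := by
        refine setLIntegral_mono (by fun_prop) fun u hu => ENNReal.ofReal_le_ofReal ?_
        exact Real.exp_le_exp.2 (neg_le_neg (mul_le_mul_of_nonneg_left hu.2 hq))

variable {S Ω : Type*} [Fintype S] [DecidableEq S] [MeasurableSpace S] [MeasurableSingletonClass S]

/-- The occupation measure of the time-space process, killed at rate `q` and at the return to level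
`0`. -/
noncomputable def occ [MeasurableSpace Ω] (c : S → ℝ) (κ : ℝ≥0 → Ω → S) (μ : Measure Ω) (q : ℝ) :
    Measure (ℝ × Ω) :=
  ((expLaw q).prod μ).restrict {p | ENNReal.ofReal p.1 < upReturn c κ p.2}

instance isFiniteMeasure_occ [MeasurableSpace Ω] (c : S → ℝ) (κ : ℝ≥0 → Ω → S) (μ : Measure Ω)
    [IsFiniteMeasure μ] (q : ℝ) [Fact (0 < q)] : IsFiniteMeasure (occ c κ μ q) := by
  unfold occ; infer_instance

/-- The function `e^{-qτ} 1{τ < ∞, κ(τ) = j}`. -/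
noncomputable def retFun (c : S → ℝ) (κ : ℝ≥0 → Ω → S) (q : ℝ) (j : S) (ω : Ω) : ℝ :=
  open Classical in
  if upReturn c κ ω = ∞ then 0 else
    Real.exp (-(q * (upReturn c κ ω).toNNReal)) *
      (Pi.single j 1 : S → ℝ) (κ (upReturn c κ ω).toNNReal ω)

/-- The generator applied to `e^{-qu} (x - X(u))⁺ 1{κ(u) = j}`, without the factor `e^{-qu}`. -/
noncomputable def localDrift (T : Matrix S S ℝ) (c : S → ℝ) (κ : ℝ≥0 → Ω → S) (q x : ℝ) (j : S)
    (p : ℝ × Ω) : ℝ :=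
  (-(q * shortfall c κ x p.1 p.2) - shortfallRate c κ x p.1 p.2) *
      (Pi.single j 1 : S → ℝ) (κ p.1.toNNReal p.2) +
    shortfall c κ x p.1 p.2 * T (κ p.1.toNNReal p.2) j

variable [MeasurableSpace Ω] {c : S → ℝ} {κ : ℝ≥0 → Ω → S}
  (hm : ∀ t, Measurable (κ t)) (hr : ∀ ω t, ∀ᶠ s in 𝓝[≥] t, κ s ω = κ t ω)
include hm hr

theorem measurableSet_lt_upReturn_prod (c : S → ℝ) :
    MeasurableSet {p : ℝ × Ω | ENNReal.ofReal p.1 < upReturn c κ p.2} :=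
  measurableSet_lt (ENNReal.measurable_ofReal.comp measurable_fst)
    ((measurable_upReturn c hm hr).comp measurable_snd)

theorem ae_occ (c : S → ℝ) (μ : Measure Ω) [SFinite μ] (q : ℝ) : ∀ᵐ p ∂(occ c κ μ q),
    0 < p.1 ∧ ENNReal.ofReal p.1 < upReturn c κ p.2 := by
  have h1 : ∀ᵐ p ∂((expLaw q).prod μ), 0 < p.1 :=
    Measure.quasiMeasurePreserving_fst.ae (ae_expLaw_pos q)
  filter_upwards [ae_restrict_of_ae h1,
    ae_restrict_mem (measurableSet_lt_upReturn_prod hm hr c)] with p h1 h2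
  exact ⟨h1, h2⟩

theorem ae_occ_nonneg (c : S → ℝ) (μ : Measure Ω) [SFinite μ] (q : ℝ) : ∀ᵐ p ∂(occ c κ μ q),
    0 ≤ addFun c κ p.1 p.2 := by
  filter_upwards [ae_occ hm hr c μ q] with p hp
  have h := addFun_nonneg_of_le_upReturn c hm hr (t := p.1.toNNReal) (ω := p.2) hp.2.le
  rwa [Real.coe_toNNReal _ hp.1.le] at h

/-- Before the return the level is nonnegative. This bound is uniform in time and dominates the
passage to an unbounded horizon. -/
theorem ae_occ_shortfall_le (c : S → ℝ) (μ : Measure Ω) [SFinite μ] (q : ℝ) {x : ℝ} (hx : 0 ≤ x) :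
    ∀ᵐ p ∂(occ c κ μ q), |shortfall c κ x p.1 p.2| ≤ x := by
  filter_upwards [ae_occ_nonneg hm hr c μ q] with p hp
  rw [shortfall, abs_of_nonneg (le_max_right _ _)]
  exact max_le (by linarith) hx

theorem measurable_phase (g : S → ℝ) : Measurable fun p : ℝ × Ω => g (κ p.1.toNNReal p.2) :=
  (measurable_of_finite g).comp (measurable_uncurry_of_rightCts hm hr)

theorem measurable_localDrift (T : Matrix S S ℝ) (q x : ℝ) (j : S) :
    Measurable (localDrift T c κ q x j) :=
  ((((measurable_uncurry_shortfall hm hr x).const_mul q).neg.sub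
    (measurable_uncurry_shortfallRate hm hr x)).mul (measurable_phase hm hr _)).add
    ((measurable_uncurry_shortfall hm hr x).mul (measurable_phase hm hr fun a => T a j))

theorem integrable_localDrift (T : Matrix S S ℝ) {q : ℝ} [hq : Fact (0 < q)] {x : ℝ} (hx : 0 ≤ x)
    (j : S) (μ : Measure Ω) [IsFiniteMeasure μ] :
    Integrable (localDrift T c κ q x j) (occ c κ μ q) := by
  refine Integrable.of_bound (measurable_localDrift hm hr T q x j).aestronglyMeasurable
    (q * x + supAbs c + x * supAbs fun a => T a j) ?_
  filter_upwards [ae_occ_shortfall_le hm hr c μ q hx] with p hp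
  refine (abs_add_le _ _).trans (add_le_add ?_ ?_)
  · rw [abs_mul]
    refine (mul_le_of_le_one_right (abs_nonneg _) (abs_single_le _ _)).trans ?_
    refine (abs_sub _ _).trans (add_le_add ?_ (abs_shortfallRate_le x _ _))
    rw [abs_neg, abs_mul, abs_of_pos hq.out]
    exact mul_le_mul_of_nonneg_left hp hq.out.le
  · rw [abs_mul]
    exact mul_le_mul hp (abs_le_supAbs (fun a => T a j) _) (abs_nonneg _) hx

-- The factor `e^{-qu}` is moved from the integrand into the measure, so that stopping at `τ ∧ t`
-- becomes a restriction of the domain.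
omit hm hr in
theorem integral_drift_eq (T : Matrix S S ℝ) (q x : ℝ) (j : S) (t : ℝ≥0) (ω : Ω) :
    ∫ u in (0 : ℝ)..(min (upReturn c κ ω) t).toNNReal, drift T κ
      (fun u ω => Real.exp (-(q * u)) * shortfall c κ x u ω)
      (fun u ω => Real.exp (-(q * u)) * (-(q * shortfall c κ x u ω) - shortfallRate c κ x u ω)) j u ω =
    ∫ u in {u : ℝ | u < t ∧ ENNReal.ofReal u < upReturn c κ ω},
      localDrift T c κ q x j (u, ω) ∂(expLaw q) := by
  have hA : MeasurableSet {u : ℝ | u < t ∧ ENNReal.ofReal u < upReturn c κ ω} :=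
    measurableSet_Iio.inter (measurableSet_lt ENNReal.measurable_ofReal measurable_const)
  have hset : {u : ℝ | u < t ∧ ENNReal.ofReal u < upReturn c κ ω} ∩ Set.Ioi 0 =
      Set.Ioo 0 ((min (upReturn c κ ω) t).toNNReal : ℝ) := by
    ext u
    simp only [Set.mem_inter_iff, Set.mem_ofPred_eq, Set.mem_Ioi, Set.mem_Ioo]
    rw [and_comm]
    refine and_congr_right fun hu => ?_
    lift u to ℝ≥0 using hu.le
    rw [NNReal.coe_lt_coe, NNReal.coe_lt_coe, ← ENNReal.coe_lt_coe (r := u)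
      (q := (min (upReturn c κ ω) t).toNNReal), ENNReal.coe_toNNReal
      (ne_top_of_le_ne_top ENNReal.coe_ne_top (min_le_right _ _)), lt_min_iff,
      ENNReal.ofReal_coe_nnreal, ENNReal.coe_lt_coe]
    tauto
  rw [setIntegral_expLaw q _ hA, hset, intervalIntegral.integral_of_le (NNReal.coe_nonneg _),
    integral_Ioc_eq_integral_Ioo]
  refine integral_congr_ae (.of_forall fun u => ?_)
  simp only [drift, localDrift]
  ring

theorem measurable_retFun (q : ℝ) (j : S) : Measurable (retFun c κ q j) := by
  have hτ := measurable_upReturn c hm hr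
  have h2 : Measurable fun ω => (((upReturn c κ ω).toNNReal : ℝ), ω) :=
    (hτ.ennreal_toNNReal.coe_nnreal_real).prodMk measurable_id
  have h3 := (measurable_phase hm hr (Pi.single j 1 : S → ℝ)).comp h2
  refine Measurable.ite (hτ (measurableSet_singleton ∞)) measurable_const ?_
  refine Measurable.mul ?_ ?_
  · exact (hτ.ennreal_toNNReal.coe_nnreal_real.const_mul q).neg.exp
  · simpa only [Function.comp_def, Real.toNNReal_coe] using h3

end Occupation

/-! ### Dynkin's identity up to the return time. -/

section Identity

variable {S Ω : Type*} [Fintype S] [DecidableEq S] [MeasurableSpace S] [MeasurableSingletonClass S]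
  [MeasurableSpace Ω] {T : Matrix S S ℝ} {κ : ℝ≥0 → Ω → S} {P : S → Measure Ω}

/-- Stop at `τ ∧ n` and let `n → ∞`. The shortfall equals `x` at time `0` and at `τ`; on `τ = ∞` the
discount removes the terminal term. -/
theorem IsMarkovFamily.integral_localDrift (hκ : IsMarkovFamily T κ P) {c : S → ℝ}
    (hc : ∀ i, c i ≠ 0) {q : ℝ} [hq : Fact (0 < q)] {x : ℝ} (hx : 0 ≤ x) (i j : S) :
    x * ∫ ω, retFun c κ q j ω ∂(P i) - ∫ p, localDrift T c κ q x j p ∂(occ c κ (P i) q) =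
      x * (Pi.single j 1 : S → ℝ) i := by
  have := hκ.isProb i
  have hm := hκ.measurable
  have hr := hκ.rightCts
  set V : ℝ → Ω → ℝ := fun u ω => Real.exp (-(q * u)) * shortfall c κ x u ω with hVdef
  set V' : ℝ → Ω → ℝ := fun u ω => Real.exp (-(q * u)) *
    (-(q * shortfall c κ x u ω) - shortfallRate c κ x u ω) with hV'def
  set ρ : ℕ → Ω → ℝ≥0 := fun n ω => (min (upReturn c κ ω) (n : ℝ≥0)).toNNReal with hρ
  have hρc : ∀ n ω, (ρ n ω : ℝ≥0∞) = min (upReturn c κ ω) (n : ℝ≥0) := fun n ω =>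
    ENNReal.coe_toNNReal (ne_top_of_le_ne_top ENNReal.coe_ne_top (min_le_right _ _))
  have hρm : ∀ n, Measurable (ρ n) := fun n =>
    ((measurable_upReturn c hm hr).min measurable_const).ennreal_toNNReal
  set N : ℕ → Ω → ℝ := fun n ω => V (ρ n ω) ω * (Pi.single j 1 : S → ℝ) (κ (ρ n ω) ω) with hN
  have hshort : ∀ n ω, |shortfall c κ x (ρ n ω) ω| ≤ x := fun n ω => by
    have := addFun_nonneg_of_le_upReturn c hm hr (ω := ω) (t := ρ n ω)
      (by rw [hρc]; exact min_le_left _ _)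
    rw [shortfall, abs_of_nonneg (le_max_right _ _)]
    exact max_le (by linarith) hx
  have hNle : ∀ n ω, |N n ω| ≤ Real.exp (-(q * ρ n ω)) * x := fun n ω => by
    simp only [hN, hVdef]
    rw [abs_mul, abs_mul, abs_of_pos (Real.exp_pos _)]
    exact (mul_le_of_le_one_right (by positivity) (abs_single_le _ _)).trans
      (mul_le_mul_of_nonneg_left (hshort n ω) (Real.exp_pos _).le)
  have hNx : ∀ n ω, |N n ω| ≤ x := fun n ω =>
    (hNle n ω).trans (mul_le_of_le_one_left hx (Real.exp_le_one_iff.2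
      (neg_nonpos.2 (mul_nonneg hq.out.le (NNReal.coe_nonneg _)))))
  have hNm : ∀ n, Measurable (N n) := fun n => by
    have h2 : Measurable fun ω => ((ρ n ω : ℝ), ω) := (hρm n).coe_nnreal_real.prodMk measurable_id
    refine Measurable.mul (Measurable.mul ?_ ?_) ?_
    · exact ((hρm n).coe_nnreal_real.const_mul q).neg.exp
    · exact (measurable_uncurry_shortfall hm hr x).comp h2
    · simpa only [Function.comp_def, Real.toNNReal_coe] using
        (measurable_phase hm hr (Pi.single j 1 : S → ℝ)).comp h2
  have hNlim : Filter.Tendsto (fun n => ∫ ω, N n ω ∂(P i)) Filter.atTop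
      (𝓝 (∫ ω, x * retFun c κ q j ω ∂(P i))) := by
    refine tendsto_integral_of_dominated_convergence (fun _ => x)
      (fun n => (hNm n).aestronglyMeasurable) (integrable_const x)
      (fun n => .of_forall (hNx n)) (.of_forall fun ω => ?_)
    by_cases htop : upReturn c κ ω = ∞
    · have hρn : ∀ n : ℕ, ρ n ω = n := fun n => by simp [hρ, htop]
      rw [retFun, if_pos htop, mul_zero]
      refine squeeze_zero_norm (hNle · ω) ?_
      simp only [hρn]
      have h1 : Filter.Tendsto (fun n : ℕ => Real.exp (-(q * (n : ℝ))) * x) Filter.atTop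
          (𝓝 (0 * x)) := by
        refine Filter.Tendsto.mul_const x (Real.tendsto_exp_neg_atTop_nhds_zero.comp ?_)
        exact Filter.Tendsto.const_mul_atTop hq.out tendsto_natCast_atTop_atTop
      simpa using h1
    · rw [retFun, if_neg htop]
      obtain ⟨n₀, hn₀⟩ := exists_nat_ge (upReturn c κ ω).toNNReal
      refine tendsto_const_nhds.congr' ?_
      filter_upwards [Filter.eventually_ge_atTop n₀] with n hn
      have hle : upReturn c κ ω ≤ (n : ℝ≥0) := by
        rw [← ENNReal.coe_toNNReal htop, ENNReal.coe_le_coe]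
        exact hn₀.trans (Nat.cast_le.2 hn)
      have hρn : ρ n ω = (upReturn c κ ω).toNNReal := by simp only [hρ, min_eq_left hle]
      simp only [hN, hVdef, hρn, shortfall, addFun_upReturn c hm hr htop, sub_zero, max_eq_left hx]
      ring
  have hDlim : Filter.Tendsto (fun n : ℕ => ∫ p in {p : ℝ × Ω | p.1 < (n : ℝ≥0)},
      localDrift T c κ q x j p ∂(occ c κ (P i) q)) Filter.atTop
      (𝓝 (∫ p, localDrift T c κ q x j p ∂(occ c κ (P i) q))) := by
    have hU : (⋃ n : ℕ, {p : ℝ × Ω | p.1 < ((n : ℝ≥0) : ℝ)}) = Set.univ := by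
      refine Set.eq_univ_of_forall fun p => ?_
      obtain ⟨n, hn⟩ := exists_nat_gt p.1
      exact Set.mem_iUnion.2 ⟨n, by simpa using hn⟩
    have h1 := tendsto_setIntegral_of_monotone (μ := occ c κ (P i) q)
      (f := localDrift T c κ q x j) (s := fun n : ℕ => {p : ℝ × Ω | p.1 < ((n : ℝ≥0) : ℝ)})
      (fun n => measurableSet_lt measurable_fst measurable_const)
      (fun a b hab p (hp : p.1 < ((a : ℝ≥0) : ℝ)) => hp.trans_le (by simpa using hab))
      (integrable_localDrift hm hr T hx j (P i)).integrableOn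
    rwa [hU, setIntegral_univ] at h1
  have hstep : ∀ n : ℕ, ∫ ω, N n ω ∂(P i) - ∫ p in {p : ℝ × Ω | p.1 < (n : ℝ≥0)},
      localDrift T c κ q x j p ∂(occ c κ (P i) q) = x * (Pi.single j 1 : S → ℝ) i := by
    intro n
    have hdyn := hκ.integral_stopped_dynkin (isRightSmooth_shortfall hc hm hr hq.out.le x (n : ℝ≥0))
      i j (σ := upReturn c κ) (measurableSet_lt_upReturn c hm hr)
    have hB1 : MeasurableSet {p : ℝ × Ω | p.1 < (n : ℝ≥0)} :=
      measurableSet_lt measurable_fst measurable_const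
    have hB2 := measurableSet_lt_upReturn_prod hm hr c
    have hint : Integrable (Set.indicator ({p : ℝ × Ω | p.1 < (n : ℝ≥0)} ∩
        {p : ℝ × Ω | ENNReal.ofReal p.1 < upReturn c κ p.2}) (localDrift T c κ q x j))
        ((expLaw q).prod (P i)) := by
      rw [integrable_indicator_iff (hB1.inter hB2), IntegrableOn, ← Measure.restrict_restrict hB1]
      exact (integrable_localDrift hm hr T hx j (P i)).integrableOn
    have hfub : ∫ p in {p : ℝ × Ω | p.1 < (n : ℝ≥0)},
        localDrift T c κ q x j p ∂(occ c κ (P i) q) =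
        ∫ ω, (∫ u in {u : ℝ | u < (n : ℝ≥0) ∧ ENNReal.ofReal u < upReturn c κ ω},
          localDrift T c κ q x j (u, ω) ∂(expLaw q)) ∂(P i) := by
      rw [occ, Measure.restrict_restrict hB1, ← integral_indicator (hB1.inter hB2),
        integral_prod_symm _ hint]
      refine integral_congr_ae (.of_forall fun ω => ?_)
      have hA : MeasurableSet {u : ℝ | u < (n : ℝ≥0) ∧ ENNReal.ofReal u < upReturn c κ ω} :=
        measurableSet_Iio.inter (measurableSet_lt ENNReal.measurable_ofReal measurable_const)
      simp only
      rw [← integral_indicator hA]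
      rfl
    have hDi : Integrable (fun ω => ∫ u in {u : ℝ | u < (n : ℝ≥0) ∧
        ENNReal.ofReal u < upReturn c κ ω}, localDrift T c κ q x j (u, ω) ∂(expLaw q)) (P i) := by
      refine hint.integral_prod_right.congr (.of_forall fun ω => ?_)
      have hA : MeasurableSet {u : ℝ | u < (n : ℝ≥0) ∧ ENNReal.ofReal u < upReturn c κ ω} :=
        measurableSet_Iio.inter (measurableSet_lt ENNReal.measurable_ofReal measurable_const)
      simp only
      rw [← integral_indicator hA]
      rfl
    have hNi : Integrable (N n) (P i) :=
      Integrable.of_bound (hNm n).aestronglyMeasurable x (.of_forall (hNx n))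
    rw [hfub, ← integral_sub hNi hDi]
    simp only [dynkin, integral_drift_eq, Real.toNNReal_coe, Real.toNNReal_zero,
      intervalIntegral.integral_same, sub_zero] at hdyn
    refine hdyn.trans ?_
    have h0 : ∀ᵐ ω ∂(P i), Real.exp (-(q * 0)) * shortfall c κ x 0 ω *
        (Pi.single j 1 : S → ℝ) (κ 0 ω) = x * (Pi.single j 1 : S → ℝ) i := by
      filter_upwards [hκ.initial i] with ω hω
      simp [hω, shortfall, addFun_zero, hx]
    rw [integral_congr_ae h0]
    simp
  have hlim := hNlim.sub hDlim
  simp only [hstep, integral_const_mul] at hlim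
  exact (tendsto_nhds_unique hlim tendsto_const_nhds)

end Identity

/-! ### From the occupation measure to an integral equation in the level. -/

section OccupationFunction

set_option linter.unusedSectionVars false

variable {S Ω : Type*} [Fintype S] [DecidableEq S] [MeasurableSpace S] [MeasurableSingletonClass S]
  [MeasurableSpace Ω]

/-- The mean discounted time spent in `[0, x] × {k}` before the return to level `0`. -/
noncomputable def occFun (c : S → ℝ) (κ : ℝ≥0 → Ω → S) (μ : Measure Ω) (q x : ℝ) (k : S) : ℝ :=
  (occ c κ μ q).real {p | addFun c κ p.1 p.2 ≤ x ∧ κ p.1.toNNReal p.2 = k}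

variable {c : S → ℝ} {κ : ℝ≥0 → Ω → S} {μ : Measure Ω} [IsFiniteMeasure μ] {q : ℝ}
  [hq : Fact (0 < q)]

theorem occFun_nonneg (x : ℝ) (k : S) : 0 ≤ occFun c κ μ q x k := measureReal_nonneg

theorem occFun_mono (k : S) : Monotone fun x => occFun c κ μ q x k := fun _ _ hxy =>
  measureReal_mono fun _ hp => ⟨hp.1.trans hxy, hp.2⟩

theorem occFun_le (x : ℝ) (k : S) : occFun c κ μ q x k ≤ (occ c κ μ q).real Set.univ :=
  measureReal_mono (Set.subset_univ _)

variable (hm : ∀ t, Measurable (κ t)) (hr : ∀ ω t, ∀ᶠ s in 𝓝[≥] t, κ s ω = κ t ω)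
include hm hr

theorem measurableSet_phase_eq (k : S) : MeasurableSet {p : ℝ × Ω | κ p.1.toNNReal p.2 = k} :=
  (measurable_uncurry_of_rightCts hm hr) (measurableSet_singleton k)

theorem measurableSet_level_le (x : ℝ) (k : S) :
    MeasurableSet {p : ℝ × Ω | addFun c κ p.1 p.2 ≤ x ∧ κ p.1.toNNReal p.2 = k} :=
  (measurableSet_le (measurable_uncurry_addFun hm hr c) measurable_const).inter
    (measurableSet_phase_eq hm hr k)

theorem occFun_eq_integral (x : ℝ) (k : S) : occFun c κ μ q x k =
    ∫ p, Set.indicator {p : ℝ × Ω | addFun c κ p.1 p.2 ≤ x} 1 p *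
      (Pi.single k 1 : S → ℝ) (κ p.1.toNNReal p.2) ∂(occ c κ μ q) := by
  rw [occFun, ← integral_indicator_one (measurableSet_level_le hm hr x k)]
  refine integral_congr_ae (.of_forall fun p => ?_)
  by_cases h1 : addFun c κ p.1 p.2 ≤ x <;> by_cases h2 : κ p.1.toNNReal p.2 = k <;>
    simp [Set.indicator, h1, h2]

/-- For a nonnegative level `X`, `(x - X)⁺ = ∫₀ˣ 1{X ≤ y} dy`; then exchange the integrals. -/
theorem integral_shortfall_mul_single {x : ℝ} (hx : 0 ≤ x) (k : S) :
    ∫ p, shortfall c κ x p.1 p.2 * (Pi.single k 1 : S → ℝ) (κ p.1.toNNReal p.2) ∂(occ c κ μ q) =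
      ∫ y in (0 : ℝ)..x, occFun c κ μ q y k := by
  simp only [occFun_eq_integral hm hr]
  rw [intervalIntegral_integral_swap]
  · refine integral_congr_ae ?_
    filter_upwards [ae_occ_nonneg hm hr c μ q] with p hp
    rw [intervalIntegral.integral_mul_const]
    congr 1
    have h1 : ∀ y : ℝ, Set.indicator {p : ℝ × Ω | addFun c κ p.1 p.2 ≤ y} (1 : ℝ × Ω → ℝ) p =
        Set.indicator (Set.Ici (addFun c κ p.1 p.2)) 1 y := fun y => by
      by_cases h : addFun c κ p.1 p.2 ≤ y <;> simp [Set.indicator, h]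
    simp only [h1]
    rw [intervalIntegral.integral_of_le hx, integral_Ioc_eq_integral_Ioo,
      ← integral_Icc_eq_integral_Ioo, integral_indicator_one measurableSet_Ici,
      measureReal_restrict_apply measurableSet_Ici]
    have h2 : Set.Ici (addFun c κ p.1 p.2) ∩ Set.Icc 0 x = Set.Icc (addFun c κ p.1 p.2) x := by
      ext y
      simp only [Set.mem_inter_iff, Set.mem_Ici, Set.mem_Icc]
      exact ⟨fun h => ⟨h.1, h.2.2⟩, fun h => ⟨h.1, hp.trans h.1, h.2⟩⟩
    rw [h2, Real.volume_real_Icc, shortfall]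
  · rw [Set.uIoc_of_le hx]
    refine Integrable.of_bound (C := 1) ?_ (.of_forall fun z => ?_)
    · refine Measurable.aestronglyMeasurable (Measurable.mul ?_ ?_)
      · have hA : MeasurableSet {z : ℝ × (ℝ × Ω) | addFun c κ z.2.1 z.2.2 ≤ z.1} :=
          measurableSet_le ((measurable_uncurry_addFun hm hr c).comp measurable_snd) measurable_fst
        exact (measurable_one (α := ℝ)).indicator hA
      · exact (measurable_phase hm hr (Pi.single k 1 : S → ℝ)).comp measurable_snd
    · simp only [Function.uncurry, norm_mul, Real.norm_eq_abs]
      refine mul_le_one₀ ?_ (abs_nonneg _) (abs_single_le _ _)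
      by_cases h : addFun c κ z.2.1 z.2.2 ≤ z.1 <;> simp [Set.indicator, h]

/-- The two sides can differ only when the level equals `x`, and every path spends zero time there.
-/
theorem ae_occ_shortfallRate (hc : ∀ i, c i ≠ 0) (x : ℝ) : ∀ᵐ p ∂(occ c κ μ q),
    shortfallRate c κ x p.1 p.2 =
      Set.indicator {p : ℝ × Ω | addFun c κ p.1 p.2 ≤ x} 1 p * c (κ p.1.toNNReal p.2) := by
  have h1 : ∀ᵐ p ∂((expLaw q).prod μ), addFun c κ p.1 p.2 ≠ x := by
    have hE : MeasurableSet {p : ℝ × Ω | addFun c κ p.1 p.2 = x} :=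
      measurableSet_eq_fun (measurable_uncurry_addFun hm hr c) measurable_const
    have : ((expLaw q).prod μ) {p : ℝ × Ω | addFun c κ p.1 p.2 = x} = 0 := by
      rw [Measure.prod_apply_symm hE]
      refine lintegral_eq_zero_of_ae_eq_zero (.of_forall fun ω => ?_)
      exact ((withDensity_absolutelyContinuous _ _).trans
        Measure.absolutelyContinuous_restrict) (volume_level_eq hc hm hr x ω)
    rw [ae_iff]
    simpa using this
  filter_upwards [ae_restrict_of_ae h1] with p hp
  rcases lt_or_gt_of_ne hp with h | h
  · simp [shortfallRate, h, h.le]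
  · have h2 : ¬ addFun c κ p.1 p.2 < x := not_lt.2 h.le
    simp [shortfallRate, h2, hp, h]

theorem integral_localDrift_eq (T : Matrix S S ℝ) (hc : ∀ i, c i ≠ 0) {x : ℝ} (hx : 0 ≤ x) (j : S) :
    ∫ p, localDrift T c κ q x j p ∂(occ c κ μ q) =
      -(c j * occFun c κ μ q x j) + ∑ k, (∫ y in (0 : ℝ)..x, occFun c κ μ q y k) *
        (T k j - q * (Pi.single j 1 : S → ℝ) k) := by
  have hs : ∀ k : S, Integrable (fun p => shortfall c κ x p.1 p.2 *
      (Pi.single k 1 : S → ℝ) (κ p.1.toNNReal p.2)) (occ c κ μ q) := fun k => by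
    refine Integrable.of_bound ((measurable_uncurry_shortfall hm hr x).mul
      (measurable_phase hm hr _)).aestronglyMeasurable x ?_
    filter_upwards [ae_occ_shortfall_le hm hr c μ q hx] with p hp
    rw [Real.norm_eq_abs, abs_mul]
    exact (mul_le_of_le_one_right (abs_nonneg _) (abs_single_le _ _)).trans hp
  have ha : Integrable (fun p => Set.indicator {p : ℝ × Ω | addFun c κ p.1 p.2 ≤ x} 1 p *
      (Pi.single j 1 : S → ℝ) (κ p.1.toNNReal p.2)) (occ c κ μ q) := by
    refine Integrable.of_bound (C := 1) (Measurable.mul ?_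
      (measurable_phase hm hr _)).aestronglyMeasurable (.of_forall fun p => ?_)
    · exact (measurable_one (α := ℝ)).indicator
        (measurableSet_le (measurable_uncurry_addFun hm hr c) measurable_const)
    · rw [Real.norm_eq_abs, abs_mul]
      refine mul_le_one₀ ?_ (abs_nonneg _) (abs_single_le _ _)
      by_cases h : addFun c κ p.1 p.2 ≤ x <;> simp [Set.indicator, h]
  have hae : ∀ᵐ p ∂(occ c κ μ q), localDrift T c κ q x j p =
      -(c j * (Set.indicator {p : ℝ × Ω | addFun c κ p.1 p.2 ≤ x} 1 p *
        (Pi.single j 1 : S → ℝ) (κ p.1.toNNReal p.2))) +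
      ∑ k, (shortfall c κ x p.1 p.2 * (Pi.single k 1 : S → ℝ) (κ p.1.toNNReal p.2)) *
        (T k j - q * (Pi.single j 1 : S → ℝ) k) := by
    filter_upwards [ae_occ_shortfallRate hm hr (μ := μ) (q := q) hc x] with p hp
    have h2 : ∑ k, (shortfall c κ x p.1 p.2 * (Pi.single k 1 : S → ℝ) (κ p.1.toNNReal p.2)) *
        (T k j - q * (Pi.single j 1 : S → ℝ) k) = shortfall c κ x p.1 p.2 *
        (T (κ p.1.toNNReal p.2) j - q * (Pi.single j 1 : S → ℝ) (κ p.1.toNNReal p.2)) := by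
      rw [Finset.sum_eq_single (κ p.1.toNNReal p.2)]
      · simp
      · intro k _ hk
        simp [Ne.symm hk]
      · simp
    rw [h2, localDrift, hp]
    by_cases h : κ p.1.toNNReal p.2 = j
    · rw [h]; ring
    · simp only [Pi.single_apply, h, if_false]; ring
  have ha' : Integrable (fun p => -(c j * (Set.indicator {p : ℝ × Ω | addFun c κ p.1 p.2 ≤ x} 1 p *
      (Pi.single j 1 : S → ℝ) (κ p.1.toNNReal p.2)))) (occ c κ μ q) := (ha.const_mul _).neg
  rw [integral_congr_ae hae, integral_add ha'
    (integrable_finsetSum _ fun k _ => (hs k).mul_const _), integral_neg, integral_const_mul,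
    ← occFun_eq_integral hm hr, integral_finsetSum _ fun k _ => (hs k).mul_const _]
  simp only [integral_mul_const, integral_shortfall_mul_single hm hr hx]

omit hq in
/-- The time spent near level `0` immediately after the start. -/
theorem one_div_le_of_tendsto_occFun [IsProbabilityMeasure μ] [hq : Fact (0 < q)] {i : S}
    (hi : 0 < c i) (hstart : ∀ᵐ ω ∂μ, κ 0 ω = i) {r : ℝ}
    (h : Filter.Tendsto (fun n : ℕ => (n + 1 : ℝ) * occFun c κ μ q (1 / (n + 1 : ℝ)) i)
      Filter.atTop (𝓝 r)) : 1 / c i ≤ r := by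
  set E : ℕ → Set (ℝ × Ω) := fun n =>
    {p | addFun c κ p.1 p.2 ≤ 1 / (n + 1 : ℝ) ∧ κ p.1.toNNReal p.2 = i} ∩
      {p | ENNReal.ofReal p.1 < upReturn c κ p.2} with hE
  have hEm : ∀ n, MeasurableSet (E n) := fun n =>
    (measurableSet_level_le hm hr _ i).inter (measurableSet_lt_upReturn_prod hm hr c)
  set f : ℕ → Ω → ℝ≥0∞ := fun n ω =>
    ENNReal.ofReal (n + 1 : ℝ) * expLaw q ((fun u => (u, ω)) ⁻¹' E n) with hf
  have hfm : ∀ n, Measurable (f n) := fun n =>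
    (measurable_measure_prodMk_right (hEm n)).const_mul _
  have hint : ∀ n, ∫⁻ ω, f n ω ∂μ =
      ENNReal.ofReal ((n + 1 : ℝ) * occFun c κ μ q (1 / (n + 1 : ℝ)) i) := fun n => by
    rw [ENNReal.ofReal_mul (by positivity), lintegral_const_mul _
      (measurable_measure_prodMk_right (hEm n)), ← Measure.prod_apply_symm (hEm n), occFun,
      ofReal_measureReal, occ, Measure.restrict_apply (measurableSet_level_le hm hr _ i)]
  have hlim := (ENNReal.continuous_ofReal.tendsto r).comp h
  -- Only a lower bound is needed, so Fatou's lemma replaces a domination argument.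
  have hfatou := lintegral_liminf_le (u := Filter.atTop) (μ := μ) hfm
  simp only [hint] at hfatou
  replace hfatou := hfatou.trans_eq hlim.liminf_eq
  have hpt : ∀ᵐ ω ∂μ, ENNReal.ofReal (1 / c i) ≤ Filter.liminf (fun n => f n ω) Filter.atTop := by
    filter_upwards [hstart] with ω hω
    obtain ⟨ε, hε, hεκ⟩ := exists_path_eq_start hr ω
    have hσ : ∀ u : ℝ, 0 < u → u < ε → ENNReal.ofReal u < upReturn c κ ω := by
      intro u hu0 hu
      rw [upReturn_of_pos c (hω ▸ hi)]
      refine lt_of_lt_of_le ((ENNReal.ofReal_lt_ofReal_iff hε).2 hu)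
        (le_returnTime c fun t ht h0 => ?_)
      rw [← ENNReal.ofReal_coe_nnreal]
      refine ENNReal.ofReal_le_ofReal (not_lt.1 fun hle => ?_)
      rw [addFun_eq_mul hεκ c t.coe_nonneg hle, hω] at h0
      have := mul_pos hi (NNReal.coe_pos.2 ht)
      linarith
    -- The time needed to climb to level `1/(n+1)` at rate `c i`; the path stays in phase `i` that
    -- long once `n` is large.
    set y : ℕ → ℝ := fun n => 1 / (n + 1 : ℝ) / c i with hy
    have hylim : Filter.Tendsto y Filter.atTop (𝓝 0) := by
      simpa [hy] using (tendsto_one_div_add_atTop_nhds_zero_nat (𝕜 := ℝ)).div_const (c i)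
    have hlow : ∀ᶠ n in Filter.atTop,
        ENNReal.ofReal (Real.exp (-(q * y n)) * (1 / c i)) ≤ f n ω := by
      filter_upwards [hylim.eventually (gt_mem_nhds hε)] with n hn
      have hsub : Set.Ioc 0 (y n) ⊆ (fun u => (u, ω)) ⁻¹' E n := by
        intro u hu
        have hue : u < ε := hu.2.trans_lt hn
        refine ⟨⟨?_, (hεκ u hue).trans hω⟩, hσ u hu.1 hue⟩
        change addFun c κ u ω ≤ _
        rw [addFun_eq_mul hεκ c hu.1.le hue, hω, mul_comm, ← le_div_iff₀ hi]
        exact hu.2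
      calc ENNReal.ofReal (Real.exp (-(q * y n)) * (1 / c i))
          = ENNReal.ofReal (n + 1 : ℝ) * ENNReal.ofReal (Real.exp (-(q * y n)) * y n) := by
            rw [← ENNReal.ofReal_mul (by positivity)]
            congr 1
            simp only [hy]
            field_simp
        _ ≤ f n ω := by
            simp only [hf]
            gcongr
            exact (ofReal_le_expLaw_Ioc q hq.out.le (y n)).trans (measure_mono hsub)
    have hlim2 : Filter.Tendsto (fun n => ENNReal.ofReal (Real.exp (-(q * y n)) * (1 / c i)))
        Filter.atTop (𝓝 (ENNReal.ofReal (1 / c i))) := by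
      have h1 : Filter.Tendsto (fun n => Real.exp (-(q * y n)) * (1 / c i)) Filter.atTop
          (𝓝 (Real.exp (-(q * 0)) * (1 / c i))) :=
        ((Real.continuous_exp.tendsto _).comp (hylim.const_mul q).neg).mul_const _
      simp only [mul_zero, neg_zero, Real.exp_zero, one_mul] at h1
      exact (ENNReal.continuous_ofReal.tendsto _).comp h1
    rw [← hlim2.liminf_eq]
    exact Filter.liminf_le_liminf hlow
  have h2 : ENNReal.ofReal (1 / c i) ≤ ENNReal.ofReal r := by
    refine le_trans ?_ hfatou
    calc ENNReal.ofReal (1 / c i) = ∫⁻ _, ENNReal.ofReal (1 / c i) ∂μ := by simp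
      _ ≤ _ := lintegral_mono_ae hpt
  have hci : 0 < 1 / c i := by positivity
  exact le_of_not_gt fun hlt => absurd h2 (not_le.2 ((ENNReal.ofReal_lt_ofReal_iff hci).2 hlt))

end OccupationFunction

/-- The integral equation for the mean discounted sojourn times. -/
theorem IsMarkovFamily.occFun_eq {S Ω : Type*} [Fintype S] [DecidableEq S] [MeasurableSpace S]
    [MeasurableSingletonClass S] [MeasurableSpace Ω] {T : Matrix S S ℝ} {κ : ℝ≥0 → Ω → S}
    {P : S → Measure Ω} (hκ : IsMarkovFamily T κ P) {c : S → ℝ} (hc : ∀ i, c i ≠ 0) {q : ℝ}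
    [Fact (0 < q)] {x : ℝ} (hx : 0 ≤ x) (i j : S) :
    c j * occFun c κ (P i) q x j =
      x * ((Pi.single j 1 : S → ℝ) i - ∫ ω, retFun c κ q j ω ∂(P i)) +
        ∑ k, (∫ y in (0 : ℝ)..x, occFun c κ (P i) q y k) *
          (T k j - q * (Pi.single j 1 : S → ℝ) k) := by
  have := hκ.isProb i
  have h := hκ.integral_localDrift hc (q := q) hx i j
  rw [integral_localDrift_eq hκ.measurable hκ.rightCts T hc hx j] at h
  linear_combination h

/-! ### Linear differential equations: bounded solutions, uniqueness, intertwining. -/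

section LinearODE

/-- At a zero of `f` the right derivative of `|f|` is `|f'|`, so the sign is that of `f'`; elsewhere
it is that of `f`. -/
theorem exists_sign_hasDerivWithinAt_abs {f : ℝ → ℝ} {f' x : ℝ} (hf : HasDerivAt f f' x) :
    ∃ s : ℝ, |s| ≤ 1 ∧ s * f x = |f x| ∧
      HasDerivWithinAt (fun y => |f y|) (s * f') (Set.Ici x) x := by
  rcases lt_trichotomy (f x) 0 with h | h | h
  · refine ⟨-1, by simp, by rw [abs_of_neg h]; ring, ?_⟩
    have h1 : (fun y => |f y|) =ᶠ[𝓝 x] fun y => -f y := by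
      filter_upwards [hf.continuousAt.eventually (gt_mem_nhds h)] with y hy
      exact abs_of_neg hy
    simpa using (hf.fun_neg.congr_of_eventuallyEq h1).hasDerivWithinAt
  · have h1 : HasDerivWithinAt (fun y => |f y|) |f'| (Set.Ici x) x := by
      rw [← hasDerivWithinAt_Ioi_iff_Ici, hasDerivWithinAt_iff_tendsto_slope' (by simp)]
      have h2 := (hasDerivWithinAt_iff_tendsto_slope' (s := Set.Ioi x) (by simp)).1
        hf.hasDerivWithinAt
      refine h2.abs.congr' ?_
      filter_upwards [self_mem_nhdsWithin] with y hy
      have hy' : 0 < y - x := sub_pos.2 hy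
      rw [slope_def_field, slope_def_field, abs_div, h, abs_zero, sub_zero, sub_zero,
        abs_of_pos hy']
    rcases le_total 0 f' with h3 | h3
    · exact ⟨1, by simp, by simp [h], by simpa [abs_of_nonneg h3] using h1⟩
    · exact ⟨-1, by simp, by simp [h], by simpa [abs_of_nonpos h3] using h1⟩
  · refine ⟨1, by simp, by rw [abs_of_pos h]; ring, ?_⟩
    have h1 : (fun y => |f y|) =ᶠ[𝓝 x] fun y => f y := by
      filter_upwards [hf.continuousAt.eventually (lt_mem_nhds h)] with y hy
      exact abs_of_pos hy
    simpa using (hf.congr_of_eventuallyEq h1).hasDerivWithinAt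

variable {S : Type*} [Fintype S] [DecidableEq S]

theorem hasDerivAt_vecMul_exp (v : S → ℝ) (A : Matrix S S ℝ) (j : S) (x : ℝ) :
    HasDerivAt (fun x : ℝ => ∑ k, v k * NormedSpace.exp (x • A) k j)
      (∑ l, (∑ k, v k * NormedSpace.exp (x • A) k l) * A l j) x := by
  refine (HasDerivAt.fun_sum (u := Finset.univ) fun k _ =>
    (hasDerivAt_exp_smul_apply A k j x).const_mul (v k)).congr_deriv ?_
  simp only [Matrix.mul_apply, Finset.sum_mul, Finset.mul_sum, mul_assoc]
  exact Finset.sum_comm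

theorem continuous_vecMul_exp (v : S → ℝ) (A : Matrix S S ℝ) (j : S) :
    Continuous fun x : ℝ => ∑ k, v k * NormedSpace.exp (x • A) k j :=
  continuous_iff_continuousAt.2 fun x => (hasDerivAt_vecMul_exp v A j x).continuousAt

/-- The matrix `(T - q) C⁻¹`. -/
noncomputable def flowMat (T : Matrix S S ℝ) (c : S → ℝ) (q : ℝ) : Matrix S S ℝ :=
  Matrix.of fun k j => (T k j - q * (Pi.single j 1 : S → ℝ) k) / c j

/-- A bounded solution of `γ' = γ (T - q) C⁻¹` is determined by its initial values in the up
phases. -/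
theorem eq_zero_of_bounded_flow {T : Matrix S S ℝ} (hT : IsGenerator T) {c : S → ℝ}
    (hc : ∀ i, c i ≠ 0) {q : ℝ} (hq : 0 < q) {v : S → ℝ} (hv : ∀ j, 0 < c j → v j = 0) {B : ℝ}
    (hB : ∀ x : ℝ, 0 ≤ x → ∀ j, |∑ k, v k * NormedSpace.exp (x • flowMat T c q) k j| ≤ B) :
    v = 0 := by
  set γ : S → ℝ → ℝ := fun j x => ∑ k, v k * NormedSpace.exp (x • flowMat T c q) k j with hγ
  set γ' : S → ℝ → ℝ := fun j x => ∑ l, γ l x * flowMat T c q l j with hγ'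
  have hd : ∀ j x, HasDerivAt (γ j) (γ' j x) x := fun j x =>
    hasDerivAt_vecMul_exp v (flowMat T c q) j x
  have hγ'c : ∀ j x, c j * γ' j x = ∑ l, γ l x * (T l j - q * (Pi.single j 1 : S → ℝ) l) := by
    intro j x
    simp only [hγ', flowMat, Matrix.of_apply, Finset.mul_sum]
    refine Finset.sum_congr rfl fun l _ => ?_
    have := hc j
    field_simp
  choose s hs1 hs2 hs3 using fun j x => exists_sign_hasDerivWithinAt_abs (hd j x)
  -- A Lyapunov function: the weights `c j` cancel the denominators of `flowMat`, and their signs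
  -- separate up from down phases.
  set L : ℝ → ℝ := fun x => ∑ j, c j * |γ j x| with hL
  set L' : ℝ → ℝ := fun x => ∑ j, c j * (s j x * γ' j x) with hL'
  set N : ℝ → ℝ := fun x => ∑ j, |γ j x| with hN
  have hN0 : ∀ x, 0 ≤ N x := fun x => Finset.sum_nonneg fun _ _ => abs_nonneg _
  have hLd : ∀ x, HasDerivWithinAt L (L' x) (Set.Ici x) x := fun x =>
    HasDerivWithinAt.fun_sum fun j _ => (hs3 j x).const_mul (c j)
  have hLc : Continuous L := continuous_finsetSum _ fun j _ =>
    continuous_const.mul (continuous_vecMul_exp v _ j).abs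
  -- The generator contributes at most zero: diagonal terms are exact, off-diagonal ones are
  -- dominated since they carry nonnegative rates, and the rows of `T` sum to zero. The killing
  -- contributes `-q N`.
  have hdis : ∀ x, L' x ≤ -(q * N x) := by
    intro x
    have h1 : L' x = ∑ l, ∑ j, s j x * γ l x * T l j - q * N x := by
      simp only [hL', hN]
      rw [Finset.mul_sum, Finset.sum_comm, ← Finset.sum_sub_distrib]
      refine Finset.sum_congr rfl fun j _ => ?_
      rw [mul_left_comm, hγ'c, Finset.mul_sum, ← hs2 j x]
      simp only [mul_sub, Finset.sum_sub_distrib]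
      congr 1
      · exact Finset.sum_congr rfl fun l _ => by ring
      · rw [Finset.sum_eq_single j]
        · simp; ring
        · intro l _ hl
          simp [hl]
        · simp
    have h2 : ∀ l, ∑ j, s j x * γ l x * T l j ≤ 0 := by
      intro l
      calc ∑ j, s j x * γ l x * T l j ≤ ∑ j, |γ l x| * T l j := by
            refine Finset.sum_le_sum fun j _ => ?_
            by_cases hjl : l = j
            · subst hjl
              rw [hs2]
            · refine mul_le_mul_of_nonneg_right ?_ (hT.nonneg_offDiag l j hjl)
              refine (le_abs_self _).trans ?_
              rw [abs_mul]
              exact mul_le_of_le_one_left (abs_nonneg _) (hs1 j x)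
        _ = 0 := by rw [← Finset.mul_sum, hT.row_sum, mul_zero]
    have h3 : ∑ l, ∑ j, s j x * γ l x * T l j ≤ 0 := Finset.sum_nonpos fun l _ => h2 l
    linarith
  set M : ℝ := supAbs c + 1 with hM
  have hM0 : 0 < M := by have := supAbs_nonneg c; positivity
  have habs : ∀ x, |L x| ≤ M * N x := by
    intro x
    simp only [hL, hN, Finset.mul_sum]
    refine (Finset.abs_sum_le_sum_abs _ _).trans (Finset.sum_le_sum fun j _ => ?_)
    rw [abs_mul, abs_abs]
    exact mul_le_mul_of_nonneg_right ((abs_le_supAbs c j).trans (by simp [hM])) (abs_nonneg _)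
  -- Since `L ≥ -M N`, this choice gives `L' ≤ -q N ≤ lam L` whatever the sign of `L`; the `+ 1` in
  -- `M` keeps the denominator positive.
  set lam : ℝ := q / M with hlam
  have hlam0 : 0 < lam := div_pos hq hM0
  have hgrow : ∀ x, 0 ≤ x → Real.exp (-(lam * x)) * L x ≤ L 0 := by
    intro x hx
    have hderiv : ∀ y, HasDerivWithinAt (fun y => Real.exp (-(lam * y)) * L y)
        (Real.exp (-(lam * y)) * -(lam * 1) * L y + Real.exp (-(lam * y)) * L' y) (Set.Ici y) y :=
      fun y => ((hasDerivAt_id y).const_mul lam).neg.exp.hasDerivWithinAt.mul (hLd y)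
    refine image_le_of_deriv_right_le_deriv_boundary (a := 0) (b := x) (B := fun _ => L 0)
      (B' := fun _ => 0) (f := fun y => Real.exp (-(lam * y)) * L y)
      ((by fun_prop : Continuous fun y : ℝ => Real.exp (-(lam * y))).mul hLc).continuousOn
      (fun y _ => hderiv y) (by simp) continuousOn_const
      (fun y _ => hasDerivWithinAt_const _ _ _) (fun y _ => ?_) ⟨hx, le_rfl⟩
    have h1 : L' y ≤ lam * L y := by
      refine (hdis y).trans ?_
      have h2 : -(M * N y) ≤ L y := (abs_le.1 (habs y)).1
      have h3 : lam * -(M * N y) ≤ lam * L y := mul_le_mul_of_nonneg_left h2 hlam0.le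
      have h4 : lam * M = q := div_mul_cancel₀ q hM0.ne'
      calc -(q * N y) = lam * -(M * N y) := by rw [← h4]; ring
        _ ≤ _ := h3
    nlinarith [Real.exp_pos (-(lam * y))]
  have hLB : ∀ x, 0 ≤ x → |L x| ≤ M * (Fintype.card S * B) := by
    intro x hx
    refine (habs x).trans (mul_le_mul_of_nonneg_left ?_ hM0.le)
    calc N x ≤ ∑ _j : S, B := Finset.sum_le_sum fun j _ => hB x hx j
      _ = _ := by simp
  -- A negative `L 0` would force `L x ≤ e^{lam x} L 0`, which is incompatible with boundedness.
  have hL0 : 0 ≤ L 0 := by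
    have hlim : Filter.Tendsto (fun x : ℝ => Real.exp (-(lam * x)) * -(M * (Fintype.card S * B)))
        Filter.atTop (𝓝 (0 * -(M * (Fintype.card S * B)))) :=
      (Real.tendsto_exp_neg_atTop_nhds_zero.comp
        (Filter.tendsto_id.const_mul_atTop hlam0)).mul_const _
    rw [zero_mul] at hlim
    refine le_of_tendsto hlim ?_
    filter_upwards [Filter.eventually_ge_atTop 0] with x hx
    exact (mul_le_mul_of_nonneg_left (abs_le.1 (hLB x hx)).1 (Real.exp_pos _).le).trans (hgrow x hx)
  have hγ0 : ∀ j, γ j 0 = v j := by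
    intro j
    simp [hγ, Matrix.one_apply]
  have hterm : ∀ j, c j * |v j| ≤ 0 := by
    intro j
    rcases lt_or_gt_of_ne (hc j) with h | h
    · exact mul_nonpos_of_nonpos_of_nonneg h.le (abs_nonneg _)
    · simp [hv j h]
  have hsum : ∑ j, c j * |v j| = 0 := by
    refine le_antisymm (Finset.sum_nonpos fun j _ => hterm j) ?_
    simpa only [hL, hγ0] using hL0
  ext j
  have h1 := (Finset.sum_eq_zero_iff_of_nonpos fun j _ => hterm j).1 hsum j (Finset.mem_univ j)
  simpa [hc j] using h1

/-- Uniqueness for the integrated linear equation `a(x) = x r + (∫₀ˣ a) A`. -/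
theorem eq_integral_vecMul_exp {A : Matrix S S ℝ} {r : S → ℝ} {a : ℝ → S → ℝ}
    (hmono : ∀ j, Monotone fun x => a x j)
    (heq : ∀ x, 0 ≤ x → ∀ j, a x j = x * r j + ∑ k, (∫ y in (0 : ℝ)..x, a y k) * A k j)
    {x : ℝ} (hx : 0 ≤ x) (j : S) :
    a x j = ∫ u in (0 : ℝ)..x, ∑ k, r k * NormedSpace.exp (u • A) k j := by
  set e : ℝ → S → ℝ := fun u j => ∑ k, r k * NormedSpace.exp (u • A) k j with he
  have hec : ∀ j, Continuous fun u => e u j := fun j => continuous_vecMul_exp r A j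
  set α : ℝ → S → ℝ := fun x j => ∫ u in (0 : ℝ)..x, e u j with hα
  have hαc : ∀ j, Continuous fun x => α x j := fun j =>
    intervalIntegral.continuous_primitive (fun _ _ => (hec j).intervalIntegrable _ _) 0
  have hαA : ∀ x j, ∑ k, α x k * A k j = e x j - r j := by
    intro x j
    have h1 := intervalIntegral.integral_eq_sub_of_hasDerivAt (a := 0) (b := x)
      (fun u _ => hasDerivAt_vecMul_exp r A j u)
      ((continuous_finsetSum _ fun k _ => (hec k).mul_const (A k j)).intervalIntegrable _ _)
    rw [intervalIntegral.integral_finsetSum fun k _ =>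
      ((hec k).mul_const (A k j)).intervalIntegrable _ _] at h1
    simp only [intervalIntegral.integral_mul_const] at h1
    rw [h1]
    simp [he, Matrix.one_apply]
  have hα2 : ∀ x j, α x j = x * r j + ∑ k, (∫ y in (0 : ℝ)..x, α y k) * A k j := by
    intro x j
    have h1 : ∑ k, (∫ y in (0 : ℝ)..x, α y k) * A k j = ∫ y in (0 : ℝ)..x, (e y j - r j) := by
      simp only [← hαA, ← intervalIntegral.integral_mul_const]
      rw [intervalIntegral.integral_finsetSum fun k _ =>
        ((hαc k).mul_const (A k j)).intervalIntegrable _ _]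
    rw [h1, intervalIntegral.integral_sub ((hec j).intervalIntegrable _ _)
      intervalIntegrable_const, intervalIntegral.integral_const]
    simp [hα]
  have hai : ∀ k s t, IntervalIntegrable (fun y => a y k) volume s t := fun k s t =>
    (hmono k).intervalIntegrable
  -- Differentiability of `a` is not assumed, so primitives are compared: `b - β` satisfies a linear
  -- equation with zero initial value, and Grönwall's inequality applies.
  set b : ℝ → S → ℝ := fun x k => ∫ y in (0 : ℝ)..x, a y k with hb
  have hbc : ∀ k, Continuous fun x => b x k := fun k =>
    intervalIntegral.continuous_primitive (hai k) 0
  set β : ℝ → S → ℝ := fun x k => ∫ y in (0 : ℝ)..x, α y k with hβ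
  have hβc : ∀ k, Continuous fun x => β x k := fun k =>
    intervalIntegral.continuous_primitive (fun _ _ => (hαc k).intervalIntegrable _ _) 0
  -- Continuity comes from the equation itself, whose right-hand side involves only primitives.
  have hac : ∀ k x, 0 ≤ x → ContinuousWithinAt (fun y => a y k) (Set.Ioi x) x := by
    intro k x hx
    have h1 : Continuous fun y => y * r k + ∑ l, b y l * A l k :=
      (continuous_id.mul_const _).add (continuous_finsetSum _ fun l _ => (hbc l).mul_const _)
    exact h1.continuousWithinAt.congr (fun y hy => heq y (hx.trans (le_of_lt hy)) k) (heq x hx k)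
  set Λ : (S → ℝ) →L[ℝ] (S → ℝ) := (Matrix.vecMulLinear A).toContinuousLinearMap with hΛ
  have hDd : ∀ y, 0 ≤ y → HasDerivWithinAt (fun y => b y - β y) (Λ (b y - β y)) (Set.Ici y) y := by
    intro y hy
    rw [hasDerivWithinAt_pi]
    intro k
    have h1 : HasDerivWithinAt (fun y => b y k) (a y k) (Set.Ici y) y :=
      intervalIntegral.integral_hasDerivWithinAt_right (t := Set.Ioi y) (hai k _ _)
        (hmono k).measurable.stronglyMeasurable.stronglyMeasurableAtFilter (hac k y hy)
    have h2 : HasDerivWithinAt (fun y => β y k) (α y k) (Set.Ici y) y :=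
      (intervalIntegral.integral_hasDerivAt_right ((hαc k).intervalIntegrable _ _)
        (hαc k).stronglyMeasurable.stronglyMeasurableAtFilter
        (hαc k).continuousAt).hasDerivWithinAt
    refine (h1.sub h2).congr_deriv ?_
    rw [heq y hy k, hα2 y k]
    simp only [hΛ, LinearMap.coe_toContinuousLinearMap', Matrix.vecMulLinear_apply, Matrix.vecMul,
      dotProduct, Pi.sub_apply, sub_mul, Finset.sum_sub_distrib]
    ring
  have hD : b x - β x = 0 := by
    have h1 := norm_le_gronwallBound_of_norm_deriv_right_le (a := 0) (b := x) (δ := 0) (ε := 0)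
      (K := ‖Λ‖) (f := fun y => b y - β y) (f' := fun y => Λ (b y - β y))
      (continuous_pi fun k => (hbc k).sub (hβc k)).continuousOn (fun y hy => hDd y hy.1)
      (by simp [hb, hβ]) (fun y _ => by
        rw [add_zero]; exact Λ.le_opNorm _) x ⟨hx, le_rfl⟩
    rw [gronwallBound_ε0_δ0] at h1
    exact norm_le_zero_iff.1 h1
  rw [heq x hx j]
  have h2 : ∀ k, b x k = β x k := fun k => sub_eq_zero.1 (congrFun hD k)
  change x * r j + ∑ k, b x k * A k j = α x j
  simp only [h2]
  exact (hα2 x j).symm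

/-- The relation passes to powers, then termwise to the series. As `r` is rectangular,
multiplication by it is treated as a continuous additive map between two matrix spaces. -/
theorem mul_exp_eq_exp_mul {m : Type*} [Fintype m] [DecidableEq m] {A : Matrix S S ℝ}
    {K : Matrix m m ℝ} {r : Matrix m S ℝ} (h : r * A = K * r) (x : ℝ) :
    r * NormedSpace.exp (x • A) = NormedSpace.exp (x • K) * r := by
  let _ := Matrix.linftyOpNormedRing (n := S) (α := ℝ)
  let _ := Matrix.linftyOpNormedAlgebra (R := ℝ) (n := S) (α := ℝ)
  let _ := Matrix.linftyOpNormedRing (n := m) (α := ℝ)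
  let _ := Matrix.linftyOpNormedAlgebra (R := ℝ) (n := m) (α := ℝ)
  have h1 := (NormedSpace.exp_series_hasSum_exp' (𝕂 := ℝ) (x • A)).map
    (AddMonoidHom.mk' (fun M : Matrix S S ℝ => r * M) (Matrix.mul_add r))
    (continuous_const.matrix_mul continuous_id)
  have h2 := (NormedSpace.exp_series_hasSum_exp' (𝕂 := ℝ) (x • K)).map
    (AddMonoidHom.mk' (fun M : Matrix m m ℝ => M * r) (fun a b => Matrix.add_mul a b r))
    (continuous_id.matrix_mul continuous_const)
  have hpow : ∀ n : ℕ, r * (x • A) ^ n = (x • K) ^ n * r := by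
    intro n
    induction n with
    | zero => simp
    | succ n ih =>
      rw [pow_succ, ← Matrix.mul_assoc, ih, Matrix.mul_assoc, Matrix.mul_smul, h, pow_succ,
        Matrix.mul_assoc, Matrix.smul_mul]
  have h3 : (AddMonoidHom.mk' (fun M : Matrix S S ℝ => r * M) (Matrix.mul_add r)) ∘
      (fun n : ℕ => ((n.factorial : ℝ)⁻¹) • (x • A) ^ n) =
      (AddMonoidHom.mk' (fun M : Matrix m m ℝ => M * r) (fun a b => Matrix.add_mul a b r)) ∘
      (fun n : ℕ => ((n.factorial : ℝ)⁻¹) • (x • K) ^ n) := by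
    ext1 n
    simp only [Function.comp, AddMonoidHom.mk'_apply, Matrix.mul_smul, Matrix.smul_mul, hpow]
  rw [h3] at h1
  exact h1.unique h2

end LinearODE

/-! ### Reduction to the up phases for a positive killing rate. -/

section Discounted

set_option linter.unusedSectionVars false

variable {S : Type*} [Fintype S] [DecidableEq S]

/-- The matrix `(I - R) C⁻¹` with rows indexed by the up phases. -/
noncomputable def rateMat (c : S → ℝ) (R : S → S → ℝ) : Matrix (Up c) S ℝ :=
  Matrix.of fun i j => ((Pi.single j 1 : S → ℝ) i - R i j) / c j

/-- The up columns of `r (T - q)`. -/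
noncomputable def growthMat (T : Matrix S S ℝ) (c : S → ℝ) (q : ℝ) (r : Matrix (Up c) S ℝ) :
    Matrix (Up c) (Up c) ℝ :=
  Matrix.of fun i k => ∑ l, r i l * (T l k - q * (Pi.single (k : S) 1 : S → ℝ) l)

/-- A bounded family of solutions of the integral equation is given by the exponential of the
reduced matrix. -/
theorem eq_F_mul_of_bounded {T : Matrix S S ℝ} (hT : IsGenerator T) {c : S → ℝ}
    (hc : ∀ i, c i ≠ 0) {q : ℝ} (hq : 0 < q) {r : Matrix (Up c) S ℝ}
    (hr : ∀ i (j : S), 0 < c j → r i j = (Pi.single j 1 : S → ℝ) i / c j)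
    {a : Up c → ℝ → S → ℝ} {B : ℝ} (hB : ∀ i x j, |a i x j| ≤ B)
    (ha : ∀ i x, 0 ≤ x → ∀ j,
      a i x j = ∫ u in (0 : ℝ)..x, ∑ k, r i k * NormedSpace.exp (u • flowMat T c q) k j)
    {x : ℝ} (hx : 0 ≤ x) (i : Up c) (j : S) :
    a i x j = (F (growthMat T c q r) x * r) i j := by
  set A := flowMat T c q with hA
  set K := growthMat T c q r with hK
  set e : Up c → ℝ → S → ℝ := fun i u j => ∑ k, r i k * NormedSpace.exp (u • A) k j with he
  have hec : ∀ i j, Continuous fun u => e i u j := fun i j => continuous_vecMul_exp (r i) A j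
  -- Integrating `e' = e A` expresses `e = r e^{xA}` through `a`, so boundedness passes from `a` to
  -- its density.
  have hebound : ∀ i x, 0 ≤ x → ∀ j, e i x j = r i j + ∑ k, a i x k * A k j := by
    intro i x hx j
    have h1 := intervalIntegral.integral_eq_sub_of_hasDerivAt (a := 0) (b := x)
      (fun u _ => hasDerivAt_vecMul_exp (r i) A j u)
      ((continuous_finsetSum _ fun k _ => (hec i k).mul_const (A k j)).intervalIntegrable _ _)
    rw [intervalIntegral.integral_finsetSum fun k _ =>
      ((hec i k).mul_const (A k j)).intervalIntegrable _ _] at h1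
    simp only [intervalIntegral.integral_mul_const] at h1
    simp only [ha i x hx]
    rw [h1]
    simp [he, Matrix.one_apply]
  set M : ℝ := ∑ i, ∑ j, (|r i j| + ∑ k, B * |A k j|) with hM
  have hB0 : ∀ _i : Up c, 0 ≤ B := fun i => (abs_nonneg _).trans (hB i 0 i)
  have heM : ∀ i x, 0 ≤ x → ∀ j, |e i x j| ≤ M := by
    intro i x hx j
    rw [hebound i x hx j]
    have h1 : |r i j + ∑ k, a i x k * A k j| ≤ |r i j| + ∑ k, B * |A k j| := by
      refine (abs_add_le _ _).trans (add_le_add le_rfl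
        ((Finset.abs_sum_le_sum_abs _ _).trans (Finset.sum_le_sum fun k _ => ?_)))
      rw [abs_mul]
      exact mul_le_mul_of_nonneg_right (hB i x k) (abs_nonneg _)
    have hnn : ∀ i' j', 0 ≤ |r i' j'| + ∑ k, B * |A k j'| := fun i' j' =>
      add_nonneg (abs_nonneg _) (Finset.sum_nonneg fun k _ => mul_nonneg (hB0 i) (abs_nonneg _))
    refine h1.trans ((Finset.single_le_sum (f := fun j => |r i j| + ∑ k, B * |A k j|)
      (fun j _ => hnn i j) (Finset.mem_univ j)).trans ?_)
    exact Finset.single_le_sum (f := fun i => ∑ j, (|r i j| + ∑ k, B * |A k j|))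
      (fun i' _ => Finset.sum_nonneg fun j' _ => hnn i' j') (Finset.mem_univ i)
  -- The up entries of `r A - K r` vanish because `K` consists of the up columns of `r (T - q)` and
  -- `r` is `C₊⁻¹` on the up columns. Its orbit under the flow is `e A - K e`, which is bounded.
  have hcomm : r * A = K * r := by
    rw [← sub_eq_zero]
    refine Matrix.ext fun i => congrFun ?_
    refine eq_zero_of_bounded_flow hT hc hq (v := (r * A - K * r) i)
      (B := ∑ j, (∑ l, M * |A l j| + ∑ k, |K i k| * M)) (fun j hj => ?_) fun x hx j => ?_
    · have h1 : (K * r) i j = K i ⟨j, hj⟩ / c j := by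
        rw [Matrix.mul_apply, Finset.sum_eq_single ⟨j, hj⟩]
        · rw [hr _ j hj]; simp [div_eq_mul_inv]
        · intro k _ hk
          rw [hr _ j hj, Pi.single_eq_of_ne (fun h => hk (Subtype.ext h)), zero_div, mul_zero]
        · simp
      rw [Matrix.sub_apply, h1, Matrix.mul_apply, sub_eq_zero]
      simp only [hK, growthMat, Matrix.of_apply, Finset.sum_div, hA, flowMat, mul_div_assoc]
    · have h1 : ∑ k, (r * A - K * r) i k * NormedSpace.exp (x • A) k j =
          ∑ l, e i x l * A l j - ∑ k, K i k * e k x j := by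
        have h2 : ∑ k, (r * A) i k * NormedSpace.exp (x • A) k j =
            (r * A * NormedSpace.exp (x • A)) i j := (Matrix.mul_apply ..).symm
        have h3 : ∑ k, (K * r) i k * NormedSpace.exp (x • A) k j =
            (K * r * NormedSpace.exp (x • A)) i j := (Matrix.mul_apply ..).symm
        simp only [Matrix.sub_apply, sub_mul, Finset.sum_sub_distrib]
        rw [h2, h3, Matrix.mul_assoc, Matrix.mul_assoc, mul_exp_eq_exp_mul (r := A) (A := A)
          (K := A) rfl x, ← Matrix.mul_assoc]
        simp only [Matrix.mul_apply, he]
      rw [h1]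
      have h2 : |∑ l, e i x l * A l j - ∑ k, K i k * e k x j| ≤
          ∑ l, M * |A l j| + ∑ k, |K i k| * M := by
        refine (abs_sub _ _).trans (add_le_add
          ((Finset.abs_sum_le_sum_abs _ _).trans (Finset.sum_le_sum fun l _ => ?_))
          ((Finset.abs_sum_le_sum_abs _ _).trans (Finset.sum_le_sum fun k _ => ?_)))
        · rw [abs_mul]
          exact mul_le_mul_of_nonneg_right (heM i x hx l) (abs_nonneg _)
        · rw [abs_mul]
          exact mul_le_mul_of_nonneg_left (heM k x hx j) (abs_nonneg _)
      have hM0 : 0 ≤ M := (abs_nonneg _).trans (heM i x hx j)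
      exact h2.trans (Finset.single_le_sum
        (f := fun j => ∑ l, M * |A l j| + ∑ k, |K i k| * M)
        (fun j _ => add_nonneg (Finset.sum_nonneg fun l _ => mul_nonneg hM0 (abs_nonneg _))
          (Finset.sum_nonneg fun k _ => mul_nonneg (abs_nonneg _) hM0)) (Finset.mem_univ j))
  rw [ha i x hx j, Matrix.mul_apply]
  simp only [F, Matrix.of_apply, ← intervalIntegral.integral_mul_const]
  rw [← intervalIntegral.integral_finsetSum fun k _ =>
    ((continuous_exp_smul_apply K i k).mul_const (r k j)).intervalIntegrable _ _]
  refine intervalIntegral.integral_congr fun u _ => ?_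
  have h := congrFun (congrFun (mul_exp_eq_exp_mul hcomm u) i) j
  simpa only [Matrix.mul_apply] using h

variable {Ω : Type*} [MeasurableSpace S] [MeasurableSingletonClass S] [MeasurableSpace Ω]
  {T : Matrix S S ℝ} {κ : ℝ≥0 → Ω → S} {P : S → Measure Ω}

/-- The Laplace transforms of the first return time. -/
noncomputable def retMat (c : S → ℝ) (κ : ℝ≥0 → Ω → S) (P : S → Measure Ω) (q : ℝ) (i j : S) : ℝ :=
  ∫ ω, retFun c κ q j ω ∂(P i)

theorem retFun_nonneg (c : S → ℝ) (κ : ℝ≥0 → Ω → S) (q : ℝ) (j : S) (ω : Ω) :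
    0 ≤ retFun c κ q j ω := by
  unfold retFun
  split_ifs
  · exact le_rfl
  · refine mul_nonneg (Real.exp_pos _).le ?_
    by_cases h : κ (upReturn c κ ω).toNNReal ω = j <;> simp [h]

theorem retMat_nonneg (c : S → ℝ) (κ : ℝ≥0 → Ω → S) (P : S → Measure Ω) (q : ℝ) (i j : S) :
    0 ≤ retMat c κ P q i j := integral_nonneg fun ω => retFun_nonneg c κ q j ω

theorem IsMarkovFamily.occFun_eq_integral_exp (hκ : IsMarkovFamily T κ P) {c : S → ℝ}
    (hc : ∀ i, c i ≠ 0) {q : ℝ} [Fact (0 < q)] {x : ℝ} (hx : 0 ≤ x) (i : Up c) (j : S) :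
    occFun c κ (P i) q x j = ∫ u in (0 : ℝ)..x, ∑ k, rateMat c (retMat c κ P q) i k *
      NormedSpace.exp (u • flowMat T c q) k j := by
  have := hκ.isProb i
  refine eq_integral_vecMul_exp (a := fun x j => occFun c κ (P i) q x j)
    (fun j => occFun_mono j) (fun x hx j => ?_) hx j
  have h := hκ.occFun_eq hc (q := q) hx i j
  have hcj := hc j
  simp only [rateMat, flowMat, Matrix.of_apply, retMat]
  calc occFun c κ (P i) q x j = c j * occFun c κ (P i) q x j / c j := by field_simp
    _ = _ := by
      rw [h, add_div, Finset.sum_div, mul_div_assoc]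
      simp only [mul_div_assoc]

/-- The fluid almost surely returns to level `0` in a down phase. -/
theorem IsMarkovFamily.retMat_up (hκ : IsMarkovFamily T κ P) {c : S → ℝ}
    (hc : ∀ i, c i ≠ 0) {q : ℝ} [Fact (0 < q)] (i : Up c) {j : S} (hj : 0 < c j) :
    retMat c κ P q i j = 0 := by
  have := hκ.isProb i
  set r := rateMat c (retMat c κ P q) i with hr
  set A := flowMat T c q with hA
  have hcont := continuous_vecMul_exp r A j
  -- The slope at level `0` of the occupation function is `r j = (δ_ij - R_ij) / c j`. It is at
  -- least `1 / c i` when `i = j` and nonnegative otherwise; either way `R_ij ≤ 0`.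
  have hderiv : HasDerivAt (fun x => ∫ u in (0 : ℝ)..x, ∑ k, r k * NormedSpace.exp (u • A) k j)
      (r j) 0 := by
    have h := intervalIntegral.integral_hasDerivAt_right (a := 0) (b := 0)
      (hcont.intervalIntegrable _ _) hcont.stronglyMeasurable.stronglyMeasurableAtFilter
      hcont.continuousAt
    refine h.congr_deriv ?_
    simp [Matrix.one_apply]
  have hseq : Filter.Tendsto (fun n : ℕ => 1 / (n + 1 : ℝ)) Filter.atTop (𝓝[≠] 0) :=
    tendsto_nhdsWithin_iff.2 ⟨tendsto_one_div_add_atTop_nhds_zero_nat,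
      .of_forall fun n => (by positivity : (0 : ℝ) < 1 / (n + 1)).ne'⟩
  have hlim : Filter.Tendsto (fun n : ℕ => (n + 1 : ℝ) * occFun c κ (P i) q (1 / (n + 1 : ℝ)) j)
      Filter.atTop (𝓝 (r j)) := by
    refine ((hasDerivAt_iff_tendsto_slope_zero.1 hderiv).comp hseq).congr fun n => ?_
    rw [hκ.occFun_eq_integral_exp hc (by positivity : (0 : ℝ) ≤ 1 / (n + 1)) i j]
    simp [hr, hA]
  have hrj : r j = ((Pi.single j 1 : S → ℝ) i - retMat c κ P q i j) / c j := rfl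
  have hR := retMat_nonneg c κ P q i j
  by_cases hij : (i : S) = j
  · subst hij
    have h1 := one_div_le_of_tendsto_occFun hκ.measurable hκ.rightCts hj (hκ.initial i) hlim
    rw [hrj, Pi.single_eq_same, div_le_div_iff_of_pos_right hj] at h1
    linarith
  · have h1 : 0 ≤ r j := ge_of_tendsto' hlim fun n =>
      mul_nonneg (by positivity) (occFun_nonneg _ _)
    have h2 := mul_nonneg h1 hj.le
    rw [hrj, Pi.single_eq_of_ne hij, zero_sub, div_mul_cancel₀ _ hj.ne'] at h2
    linarith

/-- Here positive killing is essential: the occupation measure has finite mass, so its distribution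
functions are bounded in `x` without any drift condition. -/
theorem IsMarkovFamily.occFun_eq_F_mul (hκ : IsMarkovFamily T κ P) (hT : IsGenerator T) {c : S → ℝ}
    (hc : ∀ i, c i ≠ 0) {q : ℝ} [hq : Fact (0 < q)] {x : ℝ} (hx : 0 ≤ x) (i : Up c) (j : S) :
    occFun c κ (P i) q x j =
      (F (growthMat T c q (rateMat c (retMat c κ P q))) x * rateMat c (retMat c κ P q)) i j := by
  have := hκ.isProb
  refine eq_F_mul_of_bounded hT hc hq.out (a := fun i x j => occFun c κ (P i) q x j)
    (B := ∑ i, (occ c κ (P i) q).real Set.univ) (fun i j hj => ?_) (fun i x j => ?_)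
    (fun i x hx j => hκ.occFun_eq_integral_exp hc hx i j) hx i j
  · simp [rateMat, hκ.retMat_up hc i hj]
  · rw [abs_of_nonneg (occFun_nonneg _ _)]
    exact (occFun_le _ _).trans (Finset.single_le_sum
      (f := fun i => (occ c κ (P i) q).real Set.univ) (fun _ _ => measureReal_nonneg)
      (Finset.mem_univ _))

end Discounted

/-! ### Removal of the killing. -/

section Limit

set_option linter.unusedSectionVars false

theorem continuous_F {n : Type*} [Fintype n] [DecidableEq n] (x : ℝ) :
    Continuous fun A : Matrix n n ℝ => F A x := by
  refine continuous_matrix fun i j => ?_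
  simp only [F, Matrix.of_apply]
  refine intervalIntegral.continuous_parametric_intervalIntegral_of_continuous'
    (f := fun (A : Matrix n n ℝ) (u : ℝ) => NormedSpace.exp (u • A) i j) ?_ 0 x
  exact (continuous_exp_matrix.comp (continuous_snd.smul continuous_fst)).matrix_elem i j

variable {S Ω : Type*} [Fintype S] [DecidableEq S] [MeasurableSpace S] [MeasurableSingletonClass S]
  [MeasurableSpace Ω] {T : Matrix S S ℝ} {κ : ℝ≥0 → Ω → S} {P : S → Measure Ω}

/-- A sequence of killing rates decreasing to `0`. -/
noncomputable def killRate (n : ℕ) : ℝ := 1 / (n + 1 : ℝ)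

instance fact_killRate_pos (n : ℕ) : Fact (0 < killRate n) := ⟨by unfold killRate; positivity⟩

theorem tendsto_killRate : Filter.Tendsto killRate Filter.atTop (𝓝 0) :=
  tendsto_one_div_add_atTop_nhds_zero_nat

theorem killRate_anti {m n : ℕ} (h : m ≤ n) : killRate n ≤ killRate m := by
  unfold killRate; gcongr

theorem tendsto_expLaw_killRate {A : Set ℝ} (hA : MeasurableSet A) :
    Filter.Tendsto (fun n => expLaw (killRate n) A) Filter.atTop (𝓝 (volume (A ∩ Set.Ioi 0))) := by
  simp only [expLaw, withDensity_apply _ hA, Measure.restrict_restrict hA]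
  have h1 : volume (A ∩ Set.Ioi 0) = ∫⁻ _ in A ∩ Set.Ioi 0, (1 : ℝ≥0∞) := by simp
  rw [h1]
  refine lintegral_tendsto_of_tendsto_of_monotone (fun n => by fun_prop) ?_ (.of_forall fun u => ?_)
  · filter_upwards [ae_restrict_mem (hA.inter measurableSet_Ioi)] with u hu m n hmn
    refine ENNReal.ofReal_le_ofReal (Real.exp_le_exp.2 (neg_le_neg ?_))
    exact mul_le_mul_of_nonneg_right (killRate_anti hmn) (le_of_lt hu.2)
  · have h2 : Filter.Tendsto (fun n => Real.exp (-(killRate n * u))) Filter.atTop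
        (𝓝 (Real.exp (-(0 * u)))) :=
      (Real.continuous_exp.tendsto _).comp (tendsto_killRate.mul_const u).neg
    have h3 := (ENNReal.continuous_ofReal.tendsto _).comp h2
    simpa [Function.comp_def] using h3

theorem expLaw_killRate_mono {A : Set ℝ} (hA : MeasurableSet A) :
    Monotone fun n => expLaw (killRate n) A := by
  intro m n hmn
  simp only [expLaw, withDensity_apply _ hA, Measure.restrict_restrict hA]
  refine setLIntegral_mono' (hA.inter measurableSet_Ioi) fun u hu => ?_
  refine ENNReal.ofReal_le_ofReal (Real.exp_le_exp.2 (neg_le_neg ?_))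
  exact mul_le_mul_of_nonneg_right (killRate_anti hmn) (le_of_lt hu.2)

/-- Monotone convergence, first in time and then in `ω`. Working in `ℝ≥0∞` allows an infinite limit
at this stage. -/
theorem IsMarkovFamily.tendsto_occFun (hκ : IsMarkovFamily T κ P) (c : S → ℝ) (x : ℝ) (i : Up c)
    (j : S) : Filter.Tendsto (fun n => ENNReal.ofReal (occFun c κ (P i) (killRate n) x j))
      Filter.atTop (𝓝 (∫⁻ ω, sojourn c κ x j ω ∂(P i))) := by
  have := hκ.isProb i
  have hm := hκ.measurable
  have hr := hκ.rightCts
  set E : Set (ℝ × Ω) := {p | addFun c κ p.1 p.2 ≤ x ∧ κ p.1.toNNReal p.2 = j} ∩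
    {p | ENNReal.ofReal p.1 < upReturn c κ p.2} with hE
  have hEm : MeasurableSet E :=
    (measurableSet_level_le hm hr x j).inter (measurableSet_lt_upReturn_prod hm hr c)
  have hsec : ∀ ω, MeasurableSet ((fun u => (u, ω)) ⁻¹' E) := fun ω =>
    measurable_prodMk_right hEm
  have hint : ∀ n, ENNReal.ofReal (occFun c κ (P i) (killRate n) x j) =
      ∫⁻ ω, expLaw (killRate n) ((fun u => (u, ω)) ⁻¹' E) ∂(P i) := fun n => by
    rw [← Measure.prod_apply_symm hEm, occFun, ofReal_measureReal, occ,
      Measure.restrict_apply (measurableSet_level_le hm hr x j)]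
  have hsoj : ∀ᵐ ω ∂(P i), sojourn c κ x j ω = volume ((fun u => (u, ω)) ⁻¹' E ∩ Set.Ioi 0) := by
    filter_upwards [hκ.initial i] with ω hω
    have hup : 0 < c (κ 0 ω) := hω ▸ i.2
    have h1 : (fun u => (u, ω)) ⁻¹' E ∩ Set.Ici 0 = {s : ℝ | 0 ≤ s ∧
        ENNReal.ofReal s < returnTime c κ ω ∧ level c κ s.toNNReal ω ∈ Set.Icc 0 x ∧
        κ s.toNNReal ω = j} := by
      ext s
      simp only [hE, Set.mem_inter_iff, Set.mem_preimage, Set.mem_ofPred_eq, Set.mem_Ici,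
        Set.mem_Icc, upReturn_of_pos c hup, level_eq_addFun]
      constructor
      · rintro ⟨⟨⟨h1, h2⟩, h3⟩, h4⟩
        rw [Real.coe_toNNReal _ h4]
        refine ⟨h4, h3, ⟨?_, h1⟩, h2⟩
        have h5 := addFun_nonneg_of_le_upReturn c hm hr (ω := ω) (t := s.toNNReal)
          (by rw [upReturn_of_pos c hup]; exact h3.le)
        rwa [Real.coe_toNNReal _ h4] at h5
      · rintro ⟨h4, h3, ⟨-, h1⟩, h2⟩
        rw [Real.coe_toNNReal _ h4] at h1
        exact ⟨⟨⟨h1, h2⟩, h3⟩, h4⟩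
    rw [sojourn, ← h1]
    -- `sojourn` includes time `0` while `expLaw` lives on positive times; a single point is null.
    exact measure_congr (Filter.EventuallyEq.inter (ae_eq_refl _) Ioi_ae_eq_Ici.symm)
  simp only [hint]
  rw [lintegral_congr_ae hsoj]
  exact lintegral_tendsto_of_tendsto_of_monotone
    (fun n => (measurable_measure_prodMk_right hEm).aemeasurable)
    (.of_forall fun ω => expLaw_killRate_mono (hsec ω))
    (.of_forall fun ω => tendsto_expLaw_killRate (hsec ω))

theorem abs_retFun_le (c : S → ℝ) (κ : ℝ≥0 → Ω → S) {q : ℝ} (hq : 0 ≤ q) (j : S) (ω : Ω) :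
    |retFun c κ q j ω| ≤ 1 := by
  unfold retFun
  split_ifs
  · simp
  · rw [abs_mul, abs_of_pos (Real.exp_pos _)]
    refine mul_le_one₀ ?_ (abs_nonneg _) (abs_single_le _ _)
    exact Real.exp_le_one_iff.2 (neg_nonpos.2 (mul_nonneg hq (NNReal.coe_nonneg _)))

/-- Dominated convergence. Since `retFun` is `0` on `τ = ∞` for every `q`, including `q = 0`, the
limit counts finite returns only. -/
theorem IsMarkovFamily.tendsto_retMat (hκ : IsMarkovFamily T κ P) (c : S → ℝ) (i j : S) :
    Filter.Tendsto (fun n => retMat c κ P (killRate n) i j) Filter.atTop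
      (𝓝 (retMat c κ P 0 i j)) := by
  have := hκ.isProb i
  refine tendsto_integral_of_dominated_convergence (fun _ => 1)
    (fun n => (measurable_retFun hκ.measurable hκ.rightCts _ j).aestronglyMeasurable)
    (integrable_const 1)
    (fun n => .of_forall (abs_retFun_le c κ (fact_killRate_pos n).out.le j)) (.of_forall fun ω => ?_)
  unfold retFun
  split_ifs
  · exact tendsto_const_nhds
  · exact ((Real.continuous_exp.tendsto _).comp (tendsto_killRate.mul_const _).neg).mul_const _

theorem IsMarkovFamily.retMat_zero_eq_Psi (hκ : IsMarkovFamily T κ P) (c : S → ℝ) (i : Up c)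
    (j : Down c) : retMat c κ P 0 i j = Psi c κ P i j := by
  have := hκ.isProb i
  have h1 : retFun c κ 0 j = Set.indicator {ω | upReturn c κ ω < ∞ ∧
      κ (upReturn c κ ω).toNNReal ω = j} 1 := by
    ext ω
    unfold retFun
    by_cases h : upReturn c κ ω = ∞
    · simp [h]
    · by_cases h2 : κ (upReturn c κ ω).toNNReal ω = j <;> simp [Set.indicator, h, h2, lt_top_iff_ne_top]
  have h2 : MeasurableSet {ω | upReturn c κ ω < ∞ ∧ κ (upReturn c κ ω).toNNReal ω = j} := by
    have h3 := measurable_retFun (c := c) hκ.measurable hκ.rightCts 0 (j : S)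
      (measurableSet_singleton 1)
    rw [h1] at h3
    convert h3 using 1
    ext ω
    simp [Set.indicator_apply]
  rw [retMat, h1, integral_indicator_one h2, Psi, Matrix.of_apply]
  refine measureReal_congr ?_
  filter_upwards [hκ.initial i] with ω hω
  have hup : 0 < c (κ 0 ω) := hω ▸ i.2
  simp only [Set.ofPred, upReturn_of_pos c hup]

theorem sum_eq_sum_up_add_sum_down {c : S → ℝ} (hc : ∀ i, c i ≠ 0) (f : S → ℝ) :
    ∑ l, f l = ∑ l : Up c, f l + ∑ l : Down c, f l := by
  have hbij : Function.Bijective (Sum.elim Subtype.val Subtype.val : Up c ⊕ Down c → S) := by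
    constructor
    · rintro (⟨a, ha⟩ | ⟨a, ha⟩) (⟨b, hb⟩ | ⟨b, hb⟩) h <;> simp only [Sum.elim_inl, Sum.elim_inr] at h
      · subst h; rfl
      · subst h; exact absurd ha (not_lt.2 hb.le)
      · subst h; exact absurd ha (not_lt.2 hb.le)
      · subst h; rfl
    · intro l
      rcases lt_or_gt_of_ne (hc l) with h | h
      · exact ⟨.inr ⟨l, h⟩, rfl⟩
      · exact ⟨.inl ⟨l, h⟩, rfl⟩
  rw [← (Equiv.ofBijective _ hbij).sum_comp, Fintype.sum_sum_type]
  rfl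

variable {c : S → ℝ}

theorem inv_CUp (c : S → ℝ) : (CUp c)⁻¹ = Matrix.diagonal fun i : Up c => (c i)⁻¹ := by
  refine Matrix.inv_eq_right_inv ?_
  rw [CUp, Matrix.diagonal_mul_diagonal, ← Matrix.diagonal_one]
  congr 1
  ext i
  exact mul_inv_cancel₀ i.2.ne'

theorem inv_absCDown (c : S → ℝ) :
    (absCDown c)⁻¹ = Matrix.diagonal fun i : Down c => -(c i)⁻¹ := by
  refine Matrix.inv_eq_right_inv ?_
  rw [absCDown, Matrix.diagonal_mul_diagonal, ← Matrix.diagonal_one]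
  congr 1
  ext i
  rw [abs_of_neg i.2, neg_mul_neg, mul_inv_cancel₀ i.2.ne]

theorem IsMarkovFamily.retMat_zero_up (hκ : IsMarkovFamily T κ P) (hc : ∀ i, c i ≠ 0) (i : Up c)
    {j : S} (hj : 0 < c j) : retMat c κ P 0 i j = 0 := by
  refine tendsto_nhds_unique (hκ.tendsto_retMat c i j) ?_
  simp only [hκ.retMat_up hc i hj]
  exact tendsto_const_nhds

theorem IsMarkovFamily.rateMat_inl (hκ : IsMarkovFamily T κ P) (hc : ∀ i, c i ≠ 0) (i j : Up c) :
    rateMat c (retMat c κ P 0) i j = (CUp c)⁻¹ i j := by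
  rw [inv_CUp, rateMat, Matrix.of_apply, hκ.retMat_zero_up hc i j.2, sub_zero]
  by_cases h : i = j
  · subst h; simp
  · rw [Matrix.diagonal_apply_ne _ h, Pi.single_eq_of_ne fun h' => h (Subtype.ext h'), zero_div]

/-- The identity matrix has no entry in an up row and a down column, and `-Ψ_ij / c_j = Ψ_ij /
|c_j|` because `c_j < 0`. -/
theorem IsMarkovFamily.rateMat_inr (hκ : IsMarkovFamily T κ P) (i : Up c) (j : Down c) :
    rateMat c (retMat c κ P 0) i j = (Psi c κ P * (absCDown c)⁻¹) i j := by
  have hne : (i : S) ≠ j := fun h => absurd (h ▸ i.2) (not_lt.2 j.2.le)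
  rw [inv_absCDown, Matrix.mul_diagonal, rateMat, Matrix.of_apply, hκ.retMat_zero_eq_Psi c i j,
    Pi.single_eq_of_ne hne, zero_sub, div_eq_mul_inv, neg_mul, mul_neg]

theorem IsMarkovFamily.growthMat_zero (hκ : IsMarkovFamily T κ P) (hc : ∀ i, c i ≠ 0) :
    growthMat T c 0 (rateMat c (retMat c κ P 0)) = Kmat T c κ P := by
  ext i k
  rw [growthMat, Matrix.of_apply, sum_eq_sum_up_add_sum_down hc, Kmat, Matrix.add_apply]
  refine congrArg₂ (· + ·) (Eq.trans ?_ (Matrix.mul_apply ..).symm)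
    (Eq.trans ?_ (Matrix.mul_apply ..).symm) <;>
  simp only [zero_mul, sub_zero, hκ.rateMat_inl hc, hκ.rateMat_inr, Matrix.submatrix_apply]

theorem IsMarkovFamily.tendsto_occFun_F_mul (hκ : IsMarkovFamily T κ P) (hT : IsGenerator T)
    (hc : ∀ i, c i ≠ 0) {x : ℝ} (hx : 0 ≤ x) (i : Up c) (j : S) :
    Filter.Tendsto (fun n => occFun c κ (P i) (killRate n) x j) Filter.atTop
      (𝓝 ((F (Kmat T c κ P) x * rateMat c (retMat c κ P 0)) i j)) := by
  simp only [hκ.occFun_eq_F_mul hT hc hx]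
  have hrate : Filter.Tendsto (fun n => rateMat c (retMat c κ P (killRate n))) Filter.atTop
      (𝓝 (rateMat c (retMat c κ P 0))) := by
    refine tendsto_pi_nhds.2 fun i => tendsto_pi_nhds.2 fun j => ?_
    exact (tendsto_const_nhds.sub (hκ.tendsto_retMat c i j)).div_const _
  have hgrow : Filter.Tendsto (fun n => growthMat T c (killRate n)
      (rateMat c (retMat c κ P (killRate n)))) Filter.atTop (𝓝 (Kmat T c κ P)) := by
    rw [← hκ.growthMat_zero hc]
    refine tendsto_pi_nhds.2 fun i => tendsto_pi_nhds.2 fun k => ?_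
    refine tendsto_finsetSum _ fun l _ => Filter.Tendsto.mul ?_ ?_
    · exact tendsto_pi_nhds.1 (tendsto_pi_nhds.1 hrate i) l
    · exact tendsto_const_nhds.sub (tendsto_killRate.mul_const _)
  have hF := ((continuous_F x).tendsto _).comp hgrow
  have hmul : Continuous fun M : Matrix (Up c) (Up c) ℝ × Matrix (Up c) S ℝ => (M.1 * M.2) i j :=
    (continuous_fst.matrix_mul continuous_snd).matrix_elem i j
  exact (hmul.tendsto _).comp (hF.prodMk_nhds hrate)

end Limit

end FluidQueue

theorem theoremA {S Ω : Type*} [Fintype S] [DecidableEq S] [MeasurableSpace S]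
    [MeasurableSingletonClass S] [MeasurableSpace Ω]
    (T : Matrix S S ℝ) (hT : FluidQueue.IsGenerator T)
    (c : S → ℝ) (hc : ∀ i, c i ≠ 0)
    (κ : ℝ≥0 → Ω → S) (P : S → Measure Ω) (hκ : FluidQueue.IsMarkovFamily T κ P)
    (x : ℝ) (hx : 0 ≤ x) :
    (∀ i j, FluidQueue.Gam c κ P x i j ≠ ∞) ∧
      (FluidQueue.Gam c κ P x).map ENNReal.toReal =
        FluidQueue.F (FluidQueue.Kmat T c κ P) x *
          Matrix.fromCols (FluidQueue.CUp c)⁻¹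
            (FluidQueue.Psi c κ P * (FluidQueue.absCDown c)⁻¹) := by
  -- Both sides are limits of the same discounted occupation times as the killing rate tends to `0`;
  -- the right one is finite.
  have key : ∀ i j, FluidQueue.Gam c κ P x i j = ENNReal.ofReal
      ((FluidQueue.F (FluidQueue.Kmat T c κ P) x *
        FluidQueue.rateMat c (FluidQueue.retMat c κ P 0)) i (Sum.elim Subtype.val Subtype.val j)) :=
    fun i j => tendsto_nhds_unique (hκ.tendsto_occFun c x i _)
      ((ENNReal.continuous_ofReal.tendsto _).comp (hκ.tendsto_occFun_F_mul hT hc hx i _))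
  refine ⟨fun i j => key i j ▸ ENNReal.ofReal_ne_top, ?_⟩
  ext i j
  -- `ENNReal.ofReal` truncates negative numbers, so the sign is needed to recover the matrix entry.
  have hnn : 0 ≤ (FluidQueue.F (FluidQueue.Kmat T c κ P) x *
      FluidQueue.rateMat c (FluidQueue.retMat c κ P 0)) i (Sum.elim Subtype.val Subtype.val j) :=
    ge_of_tendsto' (hκ.tendsto_occFun_F_mul hT hc hx i _) fun n => measureReal_nonneg
  rw [Matrix.map_apply, key, ENNReal.toReal_ofReal hnn, Matrix.mul_apply, Matrix.mul_apply]
  refine Finset.sum_congr rfl fun k _ => ?_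
  rcases j with j | j
  · rw [Matrix.fromCols_apply_inl, Sum.elim_inl, hκ.rateMat_inl hc]
  · rw [Matrix.fromCols_apply_inr, Sum.elim_inr, hκ.rateMat_inr]
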